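/- Let $\Omega\subset\mathbb{R}^2$ be a nonempty bounded, convex domain (open set) with $C^1$-boundary, let $|\partial\Omega|$ be its perimeter, and suppose that $$0\le L-n|\partial\Omega|\le \operatorname{diam}(\Omega)\qquad\text{for some } n\in\{0,1,2,\dots\}.$$ For a (countably) 1-rectifiable, $\mathcal H^1$-measurable set $\mathcal{L}\subset\overline\Omega$ of finite length, with unit normal $\nu(x)$ (defined up to sign at $\mathcal H^1$-almost every $x \in \mathcal{L}$) and arclength measure $\sigma=\mathcal H^1|_{\mathcal{L}}$, let $$E(\mathcal{L})=\int_{\mathcal{L}}\int_{\mathcal{L}}k(x,y)\,d\sigma(x)\,d\sigma(y)\in[0,\infty],\qquad k(x,y)=\frac{|\langle \nu(x),y-x\rangle\langle y-x,\nu(y)\rangle|}{\|x-y\|^3}.$$ In order to count copies, consider also 1-rectifiable sets with multiplicities: $\mathcal H^1$-measurable functions $\theta:\mathbb{R}^2\to\{0,1,2,\dots\}$ with support contained in $\overline\Omega$ and 1-rectifiable. Their length is $\int\theta\,d\mathcal H^1$ and their energy is $$\widehat E(\theta)=\iint k(x,y)\,\theta(x)\theta(y)\,d\mathcal H^1(x)\,d\mathcal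 H^1(y)+2\int\theta(\theta-1)\,d\mathcal H^1,$$ with $\nu$ the unit normal of the support of $\theta$; the last term is the interaction of copies that lie on top of each other (the limit of the additional mutual energy of two parallel copies of an arc, as their distance tends to $0$, is twice the length of the arc). A set $\mathcal{L}$ is the case $\theta=1_{\mathcal{L}}$, and $\widehat E(1_{\mathcal{L}})=E(\mathcal{L})$. Then $\overline\Omega$ contains a line segment of length $L-n|\partial\Omega|$, and for every line segment $K\subset\overline\Omega$ of that length, the union of $n$ copies of $\partial\Omega$ and $K$, that is $\theta_0=n1_{\partial\Omega}+1_K$, has the following properties. 1. $\theta_0$ is a 1-rectifiable set with multiplicities in $\overline\Omega$, of length $L$. 2. $\widehat E(\theta_0)\le\widehat E(\theta)$ for every 1-rectifiable set with multiplicities $\theta$ in $\overline\Omega$ of length $L$; in particular $\widehat E(\theta_0)\le E(\mathcal{L})$ for every 1-rectifiable set $\mathcal{L}\subset\overline\Omega$ of length $L$. 3. $\widehat E(\theta_0)=\inf E(\mathcal{L})$, where the infimum is over all 1-rectifiable sets $\mathcal{L}\subset\overline\Omega$ of length $L$ (without multiplicities). -/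

import Mathlib

open MeasureTheory Set
open scoped ENNReal NNReal

noncomputable section

/-- The Euclidean plane. -/
abbrev Plane : Type := EuclideanSpace ℝ (Fin 2)

/-- `Ω` has `C¹` boundary: near each boundary point, `Ω` is the sublevel set of a `C¹` function
whose differential does not vanish. -/
def HasC1Boundary (Ω : Set Plane) : Prop :=
  ∀ p ∈ frontier Ω, ∃ U : Set Plane, IsOpen U ∧ p ∈ U ∧
    ∃ g : Plane → ℝ, ContDiffOn ℝ 1 g U ∧ (∀ x ∈ U, fderiv ℝ g x ≠ 0) ∧
      Ω ∩ U = {x ∈ U | g x < 0}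

/-- The perimeter `|∂Ω|`, the one-dimensional Hausdorff measure of the boundary. -/
def perimeter (Ω : Set Plane) : ℝ := (μH[1] (frontier Ω)).toReal

/-- Countable 1-rectifiability: up to a set of length zero, `A` is covered by countably many
Lipschitz curves. -/
def IsRectifiable (A : Set Plane) : Prop :=
  ∃ γ : ℕ → ℝ → Plane, (∀ i, ∃ C : ℝ≥0, LipschitzWith C (γ i)) ∧
    μH[1] (A \ ⋃ i, range (γ i)) = 0

/-- `ν` is a unit normal field of `A`: every Lipschitz curve has, at almost every time that it
spends in `A`, a velocity orthogonal to `ν`. On a rectifiable set such a field exists and is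
unique up to sign and up to a set of length zero. -/
def IsUnitNormalField (A : Set Plane) (ν : Plane → Plane) : Prop :=
  (∀ x, ‖ν x‖ = 1) ∧
    ∀ γ : ℝ → Plane, (∃ C : ℝ≥0, LipschitzWith C γ) →
      ∀ᵐ t : ℝ, γ t ∈ A → inner ℝ (ν (γ t)) (deriv γ t) = 0

open Classical in
/-- The unit normal `n(x)` of `A` (a choice among the fields that differ by signs and null sets,
none of which affects the energy). -/
def unitNormal (A : Set Plane) : Plane → Plane :=
  if h : ∃ ν, IsUnitNormalField A ν then h.choose else 0

/-- The integrand `|⟨n(x), y - x⟩ ⟨y - x, n(y)⟩| / ‖x - y‖³`. -/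
def energyKernel (ν : Plane → Plane) (x y : Plane) : ℝ :=
  |inner ℝ (ν x) (y - x) * inner ℝ (y - x) (ν y)| / ‖x - y‖ ^ 3

/-- The energy `E(A)` of a set, the double integral over `A × A` with respect to arclength. -/
def energy (A : Set Plane) : ℝ≥0∞ :=
  ∫⁻ x in A, ∫⁻ y in A, ENNReal.ofReal (energyKernel (unitNormal A) x y) ∂μH[1] ∂μH[1]

/-- `A` is a one-dimensional rectifiable set of length `L` in the closure of `Ω`. -/
structure IsRectifiableSetIn (Ω : Set Plane) (L : ℝ) (A : Set Plane) : Prop where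
  subset : A ⊆ closure Ω
  measurable : NullMeasurableSet A μH[1]
  rectifiable : IsRectifiable A
  length_eq : μH[1] A = ENNReal.ofReal L

/-- Arclength counted with multiplicity `θ`. -/
def arclength (θ : Plane → ℕ) : Measure Plane :=
  μH[1].withDensity fun x => (θ x : ℝ≥0∞)

/-- `θ` is the multiplicity function of a one-dimensional rectifiable set with multiplicities,
contained in the closure of `Ω`, whose length counted with multiplicity is `L`. -/
structure IsRectifiableMultisetIn (Ω : Set Plane) (L : ℝ) (θ : Plane → ℕ) : Prop where
  subset : Function.support θ ⊆ closure Ω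
  measurable : AEMeasurable θ μH[1]
  rectifiable : IsRectifiable (Function.support θ)
  length_eq : arclength θ univ = ENNReal.ofReal L

/-- The energy of a set with multiplicities. The first term is the double integral over pairs of
points at distinct places. The second one is the mutual energy of copies lying on top of each
other, `2` per unit length for each of the `θ (θ - 1)` ordered pairs of distinct copies: two
parallel copies of an arc of length `s` at distance `δ → 0` have mutual energy tending to the
energy of the arc plus `2 s` (for `δ > 0`, `∫ δ² / (t² + δ²)^(3/2) dt = 2`), whereas the double
integral alone would not see this interaction when `δ = 0`. -/
def multisetEnergy (θ : Plane → ℕ) : ℝ≥0∞ :=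
  (∫⁻ x, ∫⁻ y, ENNReal.ofReal (energyKernel (unitNormal (Function.support θ)) x y)
      ∂arclength θ ∂arclength θ)
    + 2 * ∫⁻ x, ((θ x - 1 : ℕ) : ℝ≥0∞) ∂arclength θ

/-- The multiplicity function of a set (each point counted once). -/
def setMultiplicity (A : Set Plane) : Plane → ℕ := A.indicator 1

/-- The multiplicity function of the union of `n` copies of `∂Ω` and the segment `[a, b]`. -/
def boundaryCopiesAndSegment (Ω : Set Plane) (n : ℕ) (a b : Plane) : Plane → ℕ :=
  n • setMultiplicity (frontier Ω) + setMultiplicity (segment ℝ a b)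

lemma arclength_setMultiplicity {A : Set Plane} (hA : NullMeasurableSet A μH[1]) :
    arclength (setMultiplicity A) = μH[1].restrict A := by
  obtain ⟨B, -, hB, hBA⟩ := hA.exists_measurable_superset_ae_eq
  rw [← Measure.restrict_congr_set hBA, ← withDensity_indicator_one hB]
  refine withDensity_congr_ae ?_
  filter_upwards [hBA] with x hx
  have hx' : x ∈ B ↔ x ∈ A := iff_of_eq hx
  by_cases h : x ∈ A <;> simp [setMultiplicity, hx', h]

/-- On sets without multiplicity, the energy with multiplicities is the energy. -/
lemma multisetEnergy_setMultiplicity {A : Set Plane} (hA : NullMeasurableSet A μH[1]) :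
    multisetEnergy (setMultiplicity A) = energy A := by
  have hs : Function.support (setMultiplicity A) = A := by
    ext x; simp [setMultiplicity]
  have h0 : ∀ x, setMultiplicity A x - 1 = 0 := by
    intro x; by_cases h : x ∈ A <;> simp [setMultiplicity, h]
  simp [multisetEnergy, energy, hs, h0, arclength_setMultiplicity hA]

end

/-! The energy is a second moment in integral geometry. Let `N(ℓ)` be the number of points, counted
with multiplicity, in which a line `ℓ` meets `θ`, and integrate over lines with the invariant
measure. In coordinates `y = m x + c` this measure is `(1 + m²)^(-3/2) dm dc`; vertical lines do not
matter. Crofton's formula says `∫ N = 2 L`. The quadratic version says `∫ N² = Ê(θ) + 2 L`. To see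
it, note that `N²` counts pairs of points of `θ` on a common line. Two distinct points span one
line, and the Jacobian of passing from pairs of points to lines produces exactly the kernel `k`.
Coincident points contribute `2 ∫ θ² = 2 ∫ θ (θ - 1) + 2 L`, whose first part is the interaction of
superposed copies.

Since `N` is an integer or infinite, `(N - 2n)(N - 2n - 1) ≥ 0`, that is, `(4n + 1) N ≤ N² + 2n (2n
+ 1)`. The constant is needed only on lines that meet `Ω`, because almost all other lines have `N =
0`. Almost every line that meets the closure of `Ω` crosses `∂Ω` exactly twice, so by Crofton twice
the measure of these lines is `2 |∂Ω|`. Integration bounds `Ê(θ)` below by a number that depends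
only on `L`, `n` and `|∂Ω|`. Equality holds when `N` is `2n` or `2n + 1` on almost every line that
meets `Ω`. This is the case for `n` copies of `∂Ω` (two crossings each) and a segment (at most one
crossing).

For the infimum over sets without multiplicity, the copies of `∂Ω` are replaced by disjoint
homothetic copies of ratio close to `1`, and the lost length is restored by a short segment.
Crossings increase by at most those of the short segment, so the second moment increases by little.

The main steps are `lineIntegral_crossings`, `lineIntegral_crossings_sq`, `mul_le_sq_add`,
`ae_crossings_minimizer` and `exists_isRectifiableSetIn_energy_le`. The Crofton formulas rest on the
area formula (`area_formula`) and on an injective parametrization of rectifiable sets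
(`exists_isParam`). -/

open MeasureTheory Set
open scoped ENNReal NNReal

noncomputable section

/-! ### Sums over fibres and the area formula with multiplicities -/

section FiberSum

variable {α β : Type*}

/-- The sum of `g` over the points of `T` that `h` maps to `y`. -/
def fiberSum (h : α → β) (T : Set α) (g : α → ℝ≥0∞) (y : β) : ℝ≥0∞ :=
  ∑' x, (T ∩ h ⁻¹' {y}).indicator g x

lemma fiberSum_eq_zero {h : α → β} {T : Set α} {y : β} (hy : y ∉ h '' T) (g : α → ℝ≥0∞) :
    fiberSum h T g y = 0 := by
  refine ENNReal.tsum_eq_zero.2 fun x => indicator_of_notMem ?_ _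
  rintro ⟨hx, rfl⟩
  exact hy ⟨x, hx, rfl⟩

lemma fiberSum_apply_of_injOn {h : α → β} {T : Set α} (hi : InjOn h T) (g : α → ℝ≥0∞) {x : α}
    (hx : x ∈ T) : fiberSum h T g (h x) = g x := by
  rw [fiberSum, tsum_eq_single x]
  · exact indicator_of_mem (show x ∈ T ∩ h ⁻¹' {h x} from ⟨hx, rfl⟩) g
  · intro z hz
    exact indicator_of_notMem (fun hz' => hz (hi hz'.1 hx hz'.2)) _

lemma fiberSum_iUnion {h : α → β} {T : ℕ → Set α} (hT : Pairwise (Function.onFun Disjoint T))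
    (g : α → ℝ≥0∞) (y : β) : fiberSum h (⋃ i, T i) g y = ∑' i, fiberSum h (T i) g y := by
  simp only [fiberSum]
  rw [ENNReal.tsum_comm]
  refine tsum_congr fun x => ?_
  by_cases hx : ∃ i, x ∈ T i
  · obtain ⟨i, hi⟩ := hx
    rw [tsum_eq_single i]
    · by_cases hy : h x = y
      · rw [indicator_of_mem (show x ∈ (⋃ i, T i) ∩ h ⁻¹' {y} from ⟨mem_iUnion.2 ⟨i, hi⟩, hy⟩),
          indicator_of_mem (show x ∈ T i ∩ h ⁻¹' {y} from ⟨hi, hy⟩)]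
      · rw [indicator_of_notMem fun H => hy H.2, indicator_of_notMem fun H => hy H.2]
    · intro j hj
      exact indicator_of_notMem (fun H => (hT hj).le_bot ⟨H.1, hi⟩) _
  · rw [indicator_of_notMem fun H => hx (mem_iUnion.1 H.1), eq_comm]
    exact ENNReal.tsum_eq_zero.2 fun i => indicator_of_notMem (fun H => hx ⟨i, H.1⟩) _

lemma fiberSum_union {h : α → β} {S T : Set α} (hST : Disjoint S T) (g : α → ℝ≥0∞) (y : β) :
    fiberSum h (S ∪ T) g y = fiberSum h S g y + fiberSum h T g y := by
  simp only [fiberSum]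
  rw [← ENNReal.tsum_add]
  refine tsum_congr fun x => ?_
  rw [union_inter_distrib_right, indicator_union_of_disjoint]
  exact hST.mono inter_subset_left inter_subset_left

/-- A function of the target is constant on fibres. Weights on lines enter the area formula in this
way. -/
lemma fiberSum_mul_comp {h : α → β} (T : Set α) (g : α → ℝ≥0∞) (G : β → ℝ≥0∞) (y : β) :
    fiberSum h T (fun x => G (h x) * g x) y = G y * fiberSum h T g y := by
  rw [fiberSum, fiberSum, ← ENNReal.tsum_mul_left]
  refine tsum_congr fun x => ?_
  by_cases hx : x ∈ T ∩ h ⁻¹' {y}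
  · rw [indicator_of_mem hx, indicator_of_mem hx, show h x = y from hx.2]
  · rw [indicator_of_notMem hx, indicator_of_notMem hx, mul_zero]

end FiberSum

section AreaFormula

variable {E : Type*} [NormedAddCommGroup E] [NormedSpace ℝ E] [FiniteDimensional ℝ E]
  [MeasurableSpace E] [BorelSpace E] (μ : Measure E) [μ.IsAddHaarMeasure]

/-- On an injective piece the fibre sum is `g` transported by the inverse of `h` and extended by
zero, so this is the usual change of variables. -/
lemma area_formula_of_injOn {h : E → E} {T : Set E} (hT : MeasurableSet T)
    (hd : ∀ x ∈ T, DifferentiableAt ℝ h x) (hi : InjOn h T) {g : E → ℝ≥0∞} (hg : Measurable g) :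
    Measurable (fiberSum h T g) ∧
      ∫⁻ y, fiberSum h T g y ∂μ = ∫⁻ x in T, ENNReal.ofReal |(fderiv ℝ h x).det| * g x ∂μ := by
  have hd' : ∀ x ∈ T, HasFDerivWithinAt h (fderiv ℝ h x) T x := fun x hx =>
    (hd x hx).hasFDerivAt.hasFDerivWithinAt
  have hm := measurableEmbedding_of_fderivWithin hT hd' hi
  have hEq : fiberSum h T g = Function.extend (T.domRestrict h) (fun x => g x) 0 := by
    funext y
    by_cases hy : y ∈ h '' T
    · obtain ⟨x, hx, rfl⟩ := hy
      rw [fiberSum_apply_of_injOn hi g hx]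
      exact (hm.injective.extend_apply (fun x : T => g x) 0 ⟨x, hx⟩).symm
    · rw [fiberSum_eq_zero hy, Function.extend_apply']
      · rfl
      · rintro ⟨⟨x, hx⟩, rfl⟩
        exact hy ⟨x, hx, rfl⟩
  have hmeas : Measurable (fiberSum h T g) := by
    rw [hEq]
    exact hm.measurable_extend (hg.comp measurable_subtype_coe) measurable_const
  refine ⟨hmeas, ?_⟩
  have himg : MeasurableSet (h '' T) := measurable_image_of_fderivWithin hT hd' hi
  rw [← setLIntegral_eq_of_support_subset (s := h '' T)]
  · rw [lintegral_image_eq_lintegral_abs_det_fderiv_mul μ hT hd' hi]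
    refine setLIntegral_congr_fun hT fun x hx => ?_
    simp only [fiberSum_apply_of_injOn hi g hx]
  · intro y hy
    by_contra hy'
    exact hy (fiberSum_eq_zero hy' g)

/-- A differentiable map with invertible derivatives is injective on each piece of a countable
measurable partition. -/
lemma exists_partition_injOn {h : E → E} {T : Set E} (hd : ∀ x ∈ T, DifferentiableAt ℝ h x)
    (hdet : ∀ x ∈ T, (fderiv ℝ h x).det ≠ 0) :
    ∃ t : ℕ → Set E, Pairwise (Function.onFun Disjoint t) ∧ (∀ n, MeasurableSet (t n)) ∧
      T ⊆ (⋃ n, t n) ∧ ∀ n, InjOn h (T ∩ t n) := by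
  classical
  rcases T.eq_empty_or_nonempty with rfl | hne
  · refine ⟨fun _ => ∅, fun i j _ => by simp [Function.onFun], by simp, by simp, by simp⟩
  -- A map that approximates an invertible `A` within less than `‖A⁻¹‖⁻¹` is injective; half of that
  -- bound is taken. The values `1` only serve to keep the tolerance nonzero.
  let r : (E →L[ℝ] E) → ℝ≥0 := fun A =>
    if hA : A.det ≠ 0 then
      if Subsingleton E then 1 else
      ‖((A.toContinuousLinearEquivOfDetNeZero hA).symm : E →L[ℝ] E)‖₊⁻¹ / 2
    else 1
  have hr : ∀ A, r A ≠ 0 := by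
    intro A
    by_cases hA : A.det ≠ 0
    · by_cases hs : Subsingleton E
      · simp [r, hs]
      · simp only [r, hA, hs, dif_pos, if_false, ne_eq, not_false_eq_true]
        have : Nontrivial E := not_subsingleton_iff_nontrivial.1 hs
        have := (A.toContinuousLinearEquivOfDetNeZero hA).symm.norm_pos
        have h2 : (0 : ℝ≥0) <
          ‖((A.toContinuousLinearEquivOfDetNeZero hA).symm : E →L[ℝ] E)‖₊ := this
        positivity
    · simp only [r, hA, dif_neg, not_false_eq_true, ne_eq, one_ne_zero]
  obtain ⟨t, A, ht, htm, hTt, happ, hA⟩ :=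
    exists_partition_approximatesLinearOn_of_hasFDerivWithinAt h T (fderiv ℝ h)
      (fun x hx => (hd x hx).hasFDerivAt.hasFDerivWithinAt) r hr
  refine ⟨t, ht, htm, hTt, fun n => ?_⟩
  obtain ⟨y, hy, hAy⟩ := hA hne n
  have hA' : (A n).det ≠ 0 := hAy ▸ hdet y hy
  by_cases hs : Subsingleton E
  · exact fun x _ z _ _ => Subsingleton.elim _ _
  have : Nontrivial E := not_subsingleton_iff_nontrivial.1 hs
  have := happ n
  simp only [r, hA', hs, dif_pos, if_false, ne_eq, not_false_eq_true] at this
  refine ApproximatesLinearOn.injOn (f' := (A n).toContinuousLinearEquivOfDetNeZero hA')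
    (by simpa using this) (Or.inr ?_)
  have h2 : (0 : ℝ≥0) <
      ‖(((A n).toContinuousLinearEquivOfDetNeZero hA').symm : E →L[ℝ] E)‖₊ :=
    ((A n).toContinuousLinearEquivOfDetNeZero hA').symm.norm_pos
  exact NNReal.half_lt_self (by positivity)

lemma measurable_det_fderiv (h : E → E) : Measurable fun x => (fderiv ℝ h x).det :=
  ContinuousLinearMap.continuous_det.measurable.comp (measurable_fderiv ℝ h)

/-- The area formula with multiplicities. -/
theorem area_formula {h : E → E} {T : Set E} (hT : MeasurableSet T)
    (hd : ∀ x ∈ T, DifferentiableAt ℝ h x) {g : E → ℝ≥0∞} (hg : Measurable g) :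
    AEMeasurable (fiberSum h T g) μ ∧
      ∫⁻ y, fiberSum h T g y ∂μ = ∫⁻ x in T, ENNReal.ofReal |(fderiv ℝ h x).det| * g x ∂μ := by
  -- Critical points contribute to neither side: their image is null by Sard's lemma, and the
  -- Jacobian vanishes on them.
  set D : Set E := {x | (fderiv ℝ h x).det = 0} with hD
  have hDm : MeasurableSet D := measurable_det_fderiv h (measurableSet_singleton 0)
  obtain ⟨t, ht, htm, hTt, hinj⟩ := exists_partition_injOn (h := h) (T := T \ D)
    (fun x hx => hd x hx.1) (fun x hx => hx.2)
  set B : ℕ → Set E := fun n => (T \ D) ∩ t n with hB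
  have hBm : ∀ n, MeasurableSet (B n) := fun n => (hT.diff hDm).inter (htm n)
  have hBd : Pairwise (Function.onFun Disjoint B) := fun i j hij =>
    (ht hij).mono inter_subset_right inter_subset_right
  have hBU : ⋃ n, B n = T \ D := by
    rw [hB, ← inter_iUnion]; exact inter_eq_left.2 hTt
  have key := fun n => area_formula_of_injOn μ (hBm n) (fun x hx => hd x hx.1.1) (hinj n) hg
  have hnull : μ (h '' (T ∩ D)) = 0 :=
    addHaar_image_eq_zero_of_det_fderivWithin_eq_zero μ
      (fun x hx => (hd x hx.1).hasFDerivAt.hasFDerivWithinAt) (fun x hx => hx.2)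
  have hae : fiberSum h T g =ᵐ[μ] fun y => ∑' n, fiberSum h (B n) g y := by
    filter_upwards [measure_eq_zero_iff_ae_notMem.1 hnull] with y hy
    rw [← fiberSum_iUnion hBd, hBU, ← zero_add (fiberSum h (T \ D) g y),
      ← fiberSum_eq_zero hy g, ← fiberSum_union, inter_union_sdiff]
    exact disjoint_sdiff_right.mono_left inter_subset_right
  refine ⟨⟨_, Measurable.tsum fun n => (key n).1, hae⟩, ?_⟩
  rw [lintegral_congr_ae hae, lintegral_tsum fun n => (key n).1.aemeasurable]
  simp_rw [fun n => (key n).2]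
  rw [← lintegral_iUnion hBm hBd, hBU, ← lintegral_inter_add_sdiff _ T hDm, eq_comm]
  rw [setLIntegral_congr_fun (g := fun _ => 0) (hT.inter hDm), lintegral_zero, zero_add]
  intro x hx
  simp [show (fderiv ℝ h x).det = 0 from hx.2]

/-- A property that holds almost everywhere in the target holds at the image of almost every
point where the derivative is invertible. -/
lemma ae_det_eq_zero_or_of_ae {h : E → E} (hm : Measurable h) {T : Set E} (hT : MeasurableSet T)
    (hd : ∀ x ∈ T, DifferentiableAt ℝ h x) {P : E → Prop} (hP : ∀ᵐ y ∂μ, P y) :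
    ∀ᵐ x ∂μ.restrict T, (fderiv ℝ h x).det = 0 ∨ P (h x) := by
  set Z := toMeasurable μ {y | ¬ P y}
  have hZ : MeasurableSet Z := measurableSet_toMeasurable _ _
  have hZ0 : μ Z = 0 := by rw [measure_toMeasurable]; exact ae_iff.1 hP
  -- The weight is the indicator of the null set `Z` pulled back by `h`. The left side of the area
  -- formula is then zero, so Jacobian times weight vanishes almost everywhere.
  have h1 := (area_formula μ hT hd (g := fun x => Z.indicator 1 (h x) * 1)
    (((measurable_one.indicator hZ).comp hm).mul_const 1)).2
  have h2 : ∫⁻ y, fiberSum h T (fun x => Z.indicator 1 (h x) * 1) y ∂μ = 0 := by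
    simp_rw [fiberSum_mul_comp]
    rw [lintegral_eq_zero_iff' ]
    · filter_upwards [measure_eq_zero_iff_ae_notMem.1 hZ0] with y hy
      simp [hy]
    · exact (measurable_one.indicator hZ).aemeasurable.mul (area_formula μ hT hd
        measurable_const).1
  rw [h2] at h1
  have h3 := (lintegral_eq_zero_iff (((measurable_det_fderiv h).abs.ennreal_ofReal).mul
    (((measurable_one.indicator hZ).comp hm).mul_const 1))).1 h1.symm
  filter_upwards [h3] with x hx
  by_cases hxd : (fderiv ℝ h x).det = 0
  · exact Or.inl hxd
  · refine Or.inr (by_contra fun hPx => ?_)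
    have : h x ∈ Z := subset_toMeasurable _ _ hPx
    simp [this] at hx
    exact hxd hx

end AreaFormula

/-! ### Length of curves -/

/-- Points of `S` isolated from the right are countably many. At an accumulation point, a derivative
is determined by the values on `S` alone. -/
lemma ae_accPt (S : Set ℝ) : ∀ᵐ x : ℝ, x ∈ S → AccPt x (Filter.principal S) := by
  have h := (countable_setOfPred_isolated_right_within (s := S)).measure_zero volume
  filter_upwards [measure_eq_zero_iff_ae_notMem.1 h] with x hx hxS
  rw [accPt_principal_iff_nhdsWithin]
  have h1 : (nhdsWithin x (S ∩ Ioi x)).NeBot := by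
    rw [Filter.neBot_iff]
    exact fun H => hx ⟨hxS, H⟩
  exact h1.mono (nhdsWithin_mono _ fun y hy => ⟨hy.1, (ne_of_gt hy.2 : y ≠ x)⟩)

lemma disjoint_image_of_injOn {α β : Type*} {f : α → β} {S T U : Set α} (hi : InjOn f U)
    (hS : S ⊆ U) (hT : T ⊆ U) (h : Disjoint S T) : Disjoint (f '' S) (f '' T) := by
  rw [Set.disjoint_left]
  rintro _ ⟨x, hx, rfl⟩ ⟨y, hy, hxy⟩
  exact Set.disjoint_left.1 h hx (hi (hT hy) (hS hx) hxy ▸ hy)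

section CurveLength

variable {f : ℝ → Plane} {A : ℝ →L[ℝ] Plane} {P : Set ℝ} {ε : ℝ≥0}

lemma clm_apply_eq_smul_one (A : ℝ →L[ℝ] Plane) (t : ℝ) : A t = t • A 1 := by
  rw [← A.map_smul, smul_eq_mul, mul_one]

lemma ApproximatesLinearOn.hausdorffMeasure_image_le (h : ApproximatesLinearOn f A P ε) :
    μH[1] (f '' P) ≤ (‖A 1‖ₑ + ε) * volume P := by
  have hl : LipschitzOnWith (‖A 1‖₊ + ε) f P := by
    refine LipschitzOnWith.of_dist_le_mul fun x hx y hy => ?_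
    have h1 := h x hx y hy
    rw [clm_apply_eq_smul_one] at h1
    rw [dist_eq_norm, dist_eq_norm]
    calc ‖f x - f y‖ = ‖(f x - f y - (x - y) • A 1) + (x - y) • A 1‖ := by congr 1; abel
      _ ≤ ε * ‖x - y‖ + ‖x - y‖ * ‖A 1‖ := (norm_add_le _ _).trans
        (add_le_add h1 (norm_smul_le _ _))
      _ = _ := by push_cast; ring
  have := hl.hausdorffMeasure_image_le (d := 1) zero_le_one
  rw [hausdorffMeasure_real, ENNReal.rpow_one] at this
  simpa [enorm] using this

/-- If `ε < ‖A 1‖`, then `f` expands distances by at least `‖A 1‖ - ε`, so its inverse is Lipschitz.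
Otherwise the error term alone suffices. -/
lemma ApproximatesLinearOn.le_hausdorffMeasure_image (h : ApproximatesLinearOn f A P ε) :
    ‖A 1‖ₑ * volume P ≤ μH[1] (f '' P) + ε * volume P := by
  rcases le_or_gt (‖A 1‖₊) ε with ha | ha
  · refine le_add_left (mul_le_mul_left ?_ _)
    simpa [enorm] using ha
  have hanti : ∀ x ∈ P, ∀ y ∈ P, dist x y ≤ ((‖A 1‖₊ - ε)⁻¹ : ℝ≥0) * dist (f x) (f y) := by
    intro x hx y hy
    have h1 := h x hx y hy
    rw [clm_apply_eq_smul_one] at h1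
    have h2 : ‖x - y‖ * ‖A 1‖ ≤ ‖f x - f y‖ + ε * ‖x - y‖ := by
      rw [← norm_smul]
      calc ‖(x - y) • A 1‖ = ‖(f x - f y) - (f x - f y - (x - y) • A 1)‖ := by congr 1; abel
        _ ≤ _ := (norm_sub_le _ _).trans (by gcongr)
    have h3 : (0 : ℝ) < ‖A 1‖ - ε := sub_pos.2 (by exact_mod_cast ha)
    rw [NNReal.coe_inv, NNReal.coe_sub ha.le, coe_nnnorm, dist_eq_norm, dist_eq_norm,
      inv_mul_eq_div, le_div_iff₀ h3]
    linarith
  have hinj : InjOn f P := by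
    intro x hx y hy hxy
    have := hanti x hx y hy
    rw [hxy, dist_self, mul_zero] at this
    exact dist_le_zero.1 this
  have hl : LipschitzOnWith (‖A 1‖₊ - ε)⁻¹ (Function.invFunOn f P) (f '' P) := by
    refine LipschitzOnWith.of_dist_le_mul ?_
    rintro _ ⟨x, hx, rfl⟩ _ ⟨y, hy, rfl⟩
    rw [hinj.leftInvOn_invFunOn hx, hinj.leftInvOn_invFunOn hy]
    exact hanti x hx y hy
  have h1 := hl.hausdorffMeasure_image_le (d := 1) zero_le_one
  rw [hausdorffMeasure_real, ENNReal.rpow_one, hinj.leftInvOn_invFunOn.image_image] at h1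
  have h0 : ‖A 1‖₊ - ε ≠ 0 := (tsub_pos_of_lt ha).ne'
  have h2 : ((‖A 1‖₊ - ε : ℝ≥0) : ℝ≥0∞) * volume P ≤ μH[1] (f '' P) := by
    calc ((‖A 1‖₊ - ε : ℝ≥0) : ℝ≥0∞) * volume P
        ≤ ((‖A 1‖₊ - ε : ℝ≥0) : ℝ≥0∞) * ((((‖A 1‖₊ - ε)⁻¹ : ℝ≥0) : ℝ≥0∞) * μH[1] (f '' P)) := by
          gcongr
      _ = μH[1] (f '' P) := by
        rw [← mul_assoc, ← ENNReal.coe_mul, mul_inv_cancel₀ h0, ENNReal.coe_one, one_mul]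
  calc ‖A 1‖ₑ * volume P = ((‖A 1‖₊ - ε : ℝ≥0) + ε) * volume P := by
        rw [← ENNReal.coe_add, tsub_add_cancel_of_le ha.le]; rfl
    _ ≤ _ := by rw [add_mul]; gcongr

/-- At accumulation points of `P`, the derivative of `f - A` is a limit of slopes within `P`, which
are bounded by `ε`. -/
lemma ApproximatesLinearOn.ae_norm_deriv_sub_le (h : ApproximatesLinearOn f A P ε)
    (hd : ∀ x ∈ P, DifferentiableAt ℝ f x) :
    ∀ᵐ x : ℝ, x ∈ P → ‖deriv f x - A 1‖ ≤ ε := by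
  filter_upwards [ae_accPt P] with x hx hxP
  have hacc := hx hxP
  rw [accPt_principal_iff_nhdsWithin] at hacc
  have h1 : HasDerivWithinAt (fun y => f y - A y) (deriv f x - A 1) P x :=
    ((hd x hxP).hasDerivAt.sub A.hasDerivAt).hasDerivWithinAt
  rw [hasDerivWithinAt_iff_tendsto_slope] at h1
  refine le_of_tendsto h1.norm ?_
  filter_upwards [self_mem_nhdsWithin] with y hy
  have h2 := h y hy.1 x hxP
  have hyx : 0 < ‖y - x‖ := norm_pos_iff.2 (sub_ne_zero.2 hy.2)
  rw [slope_def_module, norm_smul, norm_inv, inv_mul_le_iff₀ hyx, mul_comm]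
  refine le_of_eq_of_le (congrArg norm ?_) h2
  rw [A.map_sub]; abel

lemma exists_partition_curve {T : Set ℝ} (hT : MeasurableSet T)
    (hd : ∀ x ∈ T, DifferentiableAt ℝ f x) (hε : ε ≠ 0) :
    ∃ (P : ℕ → Set ℝ) (A : ℕ → ℝ →L[ℝ] Plane), Pairwise (Function.onFun Disjoint P) ∧
      (∀ n, MeasurableSet (P n)) ∧ ⋃ n, P n = T ∧ ∀ n, ApproximatesLinearOn f (A n) (P n) ε := by
  obtain ⟨t, A, ht, htm, hTt, happ, -⟩ :=
    exists_partition_approximatesLinearOn_of_hasFDerivWithinAt f T (fderiv ℝ f)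
      (fun x hx => (hd x hx).hasFDerivAt.hasFDerivWithinAt) (fun _ => ε) (fun _ => hε)
  refine ⟨fun n => T ∩ t n, A, fun i j hij => (ht hij).mono inter_subset_right inter_subset_right,
    fun n => hT.inter (htm n), ?_, happ⟩
  rw [← inter_iUnion]; exact inter_eq_left.2 hTt

/-- One `ε` comes from the Lipschitz constant on a piece, the other from replacing `A 1` by the
derivative. -/
lemma hausdorffMeasure_image_le_lintegral_add {T : Set ℝ} (hT : MeasurableSet T)
    (hd : ∀ x ∈ T, DifferentiableAt ℝ f x) (hε : ε ≠ 0) :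
    μH[1] (f '' T) ≤ (∫⁻ t in T, ‖deriv f t‖ₑ) + 2 * ε * volume T := by
  obtain ⟨P, A, hP, hPm, rfl, happ⟩ := exists_partition_curve hT hd hε
  have hpiece : ∀ n, μH[1] (f '' P n) ≤ ∫⁻ t in P n, (‖deriv f t‖ₑ + 2 * ε) := by
    intro n
    refine (happ n).hausdorffMeasure_image_le.trans ?_
    rw [← setLIntegral_const]
    refine setLIntegral_mono_ae' (hPm n) ?_
    filter_upwards [(happ n).ae_norm_deriv_sub_le fun x hx => hd x (mem_iUnion_of_mem n hx)]
      with x hx hxP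
    have h1 : ‖A n 1‖ₑ ≤ ‖deriv f x‖ₑ + ε := by
      have h2 : ‖A n 1‖₊ ≤ ‖deriv f x‖₊ + ε := by
        have := hx hxP
        rw [← NNReal.coe_le_coe]; push_cast
        linarith [norm_sub_norm_le (A n 1) (deriv f x), norm_sub_rev (A n 1) (deriv f x)]
      simpa [enorm] using ENNReal.coe_le_coe.2 h2
    calc ‖A n 1‖ₑ + ε ≤ ‖deriv f x‖ₑ + ε + ε := by gcongr
      _ = _ := by rw [add_assoc, two_mul]
  rw [image_iUnion]
  refine (measure_iUnion_le _).trans ((ENNReal.tsum_le_tsum hpiece).trans ?_)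
  rw [← lintegral_iUnion hPm hP, lintegral_add_right _ measurable_const, setLIntegral_const]

lemma lintegral_le_hausdorffMeasure_image_add {T : Set ℝ} (hT : MeasurableSet T)
    (hd : ∀ x ∈ T, DifferentiableAt ℝ f x) (hi : InjOn f T) (hε : ε ≠ 0) :
    (∫⁻ t in T, ‖deriv f t‖ₑ) ≤ μH[1] (f '' T) + 2 * ε * volume T := by
  obtain ⟨P, A, hP, hPm, rfl, happ⟩ := exists_partition_curve hT hd hε
  have hpiece : ∀ n, (∫⁻ t in P n, ‖deriv f t‖ₑ) ≤ μH[1] (f '' P n) + 2 * ε * volume (P n) := by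
    intro n
    calc (∫⁻ t in P n, ‖deriv f t‖ₑ) ≤ ∫⁻ _ in P n, (‖A n 1‖ₑ + ε) := by
          refine setLIntegral_mono_ae' (hPm n) ?_
          filter_upwards [(happ n).ae_norm_deriv_sub_le
            fun x hx => hd x (mem_iUnion_of_mem n hx)] with x hx hxP
          have h2 : ‖deriv f x‖₊ ≤ ‖A n 1‖₊ + ε := by
            have := hx hxP
            rw [← NNReal.coe_le_coe]; push_cast
            linarith [norm_sub_norm_le (deriv f x) (A n 1)]
          simpa [enorm] using ENNReal.coe_le_coe.2 h2
      _ = ‖A n 1‖ₑ * volume (P n) + ε * volume (P n) := by rw [setLIntegral_const, add_mul]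
      _ ≤ μH[1] (f '' P n) + ε * volume (P n) + ε * volume (P n) := by
        gcongr; exact (happ n).le_hausdorffMeasure_image
      _ = _ := by rw [two_mul, add_mul, add_assoc]
  have himg : ∀ n, MeasurableSet (f '' P n) := fun n =>
    (hPm n).image_of_continuousOn_injOn
      (fun x hx => (hd x (mem_iUnion_of_mem n hx)).continuousAt.continuousWithinAt)
      (hi.mono (subset_iUnion P n))
  rw [lintegral_iUnion hPm hP, image_iUnion, measure_iUnion _ himg, measure_iUnion hP hPm,
    ← ENNReal.tsum_mul_left, ← ENNReal.tsum_add]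
  · exact ENNReal.tsum_le_tsum hpiece
  · intro i j hij
    exact disjoint_image_of_injOn hi (subset_iUnion P i) (subset_iUnion P j) (hP hij)

lemma le_of_forall_le_add_mul {a b v : ℝ≥0∞} (hv : v ≠ ∞)
    (h : ∀ ε : ℝ≥0, ε ≠ 0 → a ≤ b + 2 * ε * v) : a ≤ b := by
  lift v to ℝ≥0 using hv
  refine ENNReal.le_of_forall_pos_le_add fun δ hδ _ => (h (δ / (2 * (v + 1))) (by positivity)).trans
    (add_le_add le_rfl ?_)
  norm_cast
  have : 0 < v + 1 := by positivity
  rw [← NNReal.coe_le_coe]; push_cast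
  have hv : (0 : ℝ) < v + 1 := by positivity
  rw [show (2 : ℝ) * (δ / (2 * (v + 1))) * v = δ * v / (v + 1) by field_simp, div_le_iff₀ hv]
  nlinarith [δ.coe_nonneg]

lemma volume_inter_Ico_ne_top (T : Set ℝ) (k : ℤ) : volume (T ∩ Ico (k : ℝ) (k + 1)) ≠ ∞ :=
  (measure_lt_top_of_subset inter_subset_right (by simp)).ne

/-- The image of a set of times has at most the length of the curve. -/
lemma hausdorffMeasure_image_le_lintegral {T : Set ℝ} (hT : MeasurableSet T)
    (hd : ∀ x ∈ T, DifferentiableAt ℝ f x) :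
    μH[1] (f '' T) ≤ ∫⁻ t in T, ‖deriv f t‖ₑ := by
  -- Cutting into unit intervals makes the volume in the error term finite, so that `ε` can tend to
  -- zero.
  have hU : T = ⋃ k : ℤ, T ∩ Ico (k : ℝ) (k + 1) := by
    rw [← inter_iUnion, iUnion_Ico_intCast, inter_univ]
  have hm : ∀ k : ℤ, MeasurableSet (T ∩ Ico (k : ℝ) (k + 1)) := fun k => hT.inter measurableSet_Ico
  have hdisj : Pairwise (Function.onFun Disjoint fun k : ℤ => T ∩ Ico (k : ℝ) (k + 1)) :=
    fun i j hij => (pairwise_disjoint_Ico_intCast ℝ hij).mono inter_subset_right inter_subset_right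
  rw [hU, image_iUnion, lintegral_iUnion hm hdisj]
  exact (measure_iUnion_le _).trans (ENNReal.tsum_le_tsum fun k =>
    le_of_forall_le_add_mul (volume_inter_Ico_ne_top T k) fun ε hε =>
      hausdorffMeasure_image_le_lintegral_add (hm k) (fun x hx => hd x hx.1) hε)

/-- The length of a curve that is injective on a set of times. -/
theorem hausdorffMeasure_image_eq_lintegral {T : Set ℝ} (hT : MeasurableSet T)
    (hd : ∀ x ∈ T, DifferentiableAt ℝ f x) (hi : InjOn f T) :
    μH[1] (f '' T) = ∫⁻ t in T, ‖deriv f t‖ₑ := by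
  refine le_antisymm (hausdorffMeasure_image_le_lintegral hT hd) ?_
  have hU : T = ⋃ k : ℤ, T ∩ Ico (k : ℝ) (k + 1) := by
    rw [← inter_iUnion, iUnion_Ico_intCast, inter_univ]
  have hm : ∀ k : ℤ, MeasurableSet (T ∩ Ico (k : ℝ) (k + 1)) := fun k => hT.inter measurableSet_Ico
  have hdisj : Pairwise (Function.onFun Disjoint fun k : ℤ => T ∩ Ico (k : ℝ) (k + 1)) :=
    fun i j hij => (pairwise_disjoint_Ico_intCast ℝ hij).mono inter_subset_right inter_subset_right
  have himg : ∀ k : ℤ, MeasurableSet (f '' (T ∩ Ico (k : ℝ) (k + 1))) := fun k =>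
    (hm k).image_of_continuousOn_injOn (fun x hx => (hd x hx.1).continuousAt.continuousWithinAt)
      (hi.mono inter_subset_left)
  rw [hU, image_iUnion, lintegral_iUnion hm hdisj, measure_iUnion _ himg]
  · exact ENNReal.tsum_le_tsum fun k =>
      le_of_forall_le_add_mul (volume_inter_Ico_ne_top T k) fun ε hε =>
        lintegral_le_hausdorffMeasure_image_add (hm k) (fun x hx => hd x hx.1)
          (hi.mono inter_subset_left) hε
  · intro i j hij
    exact disjoint_image_of_injOn hi inter_subset_left inter_subset_left (hdisj hij)

end CurveLength

/-! ### Parametrization of rectifiable sets -/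

/-- `f` parametrizes a rectifiable set injectively, with nonzero velocity, by the times in `T`,
and its velocity is tangent to every set that it runs in. -/
structure IsParam (f : ℝ → Plane) (T : Set ℝ) : Prop where
  measurable : Measurable f
  measurableSet : MeasurableSet T
  injOn : InjOn f T
  differentiableAt : ∀ t ∈ T, DifferentiableAt ℝ f t
  deriv_ne_zero : ∀ t ∈ T, deriv f t ≠ 0
  normal : ∀ A ν, IsUnitNormalField A ν →
    ∀ᵐ t : ℝ, t ∈ T → f t ∈ A → inner ℝ (ν (f t)) (deriv f t) = 0

/-- A curve with nonzero velocity is expanding on each piece of a countable partition. -/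
lemma exists_partition_antilipschitz {f : ℝ → Plane} {T : Set ℝ} (hT : MeasurableSet T)
    (hd : ∀ x ∈ T, DifferentiableAt ℝ f x) (hd0 : ∀ x ∈ T, deriv f x ≠ 0) :
    ∃ P : ℕ → Set ℝ, (∀ n, MeasurableSet (P n)) ∧ ⋃ n, P n = T ∧
      ∀ n, ∃ c : ℝ, 0 < c ∧ ∀ x ∈ P n, ∀ y ∈ P n, c * |x - y| ≤ ‖f x - f y‖ := by
  classical
  rcases T.eq_empty_or_nonempty with rfl | hne
  · exact ⟨fun _ => ∅, by simp, by simp, fun _ => ⟨1, one_pos, by simp⟩⟩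
  obtain ⟨t, A, ht, htm, hTt, happ, hA⟩ :=
    exists_partition_approximatesLinearOn_of_hasFDerivWithinAt f T (fderiv ℝ f)
      (fun x hx => (hd x hx).hasFDerivAt.hasFDerivWithinAt)
      -- A tolerance of half the speed leaves expansion by the other half. The value `1` is a
      -- nonzero default, never used at the velocities that occur.
      (fun A => if A 1 = 0 then 1 else ‖A 1‖₊ / 2) (fun A => by
        by_cases h : A 1 = 0
        · simp [h]
        · simp [h])
  refine ⟨fun n => T ∩ t n, fun n => hT.inter (htm n), ?_, fun n => ?_⟩
  · rw [← inter_iUnion]; exact inter_eq_left.2 hTt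
  obtain ⟨y, hy, hAy⟩ := hA hne n
  have h0 : A n 1 ≠ 0 := by rw [hAy]; exact hd0 y hy
  refine ⟨‖A n 1‖ / 2, by positivity, fun x hx y hy => ?_⟩
  have h1 := happ n x hx y hy
  simp only [h0, if_false] at h1
  rw [clm_apply_eq_smul_one] at h1
  push_cast at h1
  have h2 : ‖x - y‖ * ‖A n 1‖ ≤ ‖f x - f y‖ + ‖A n 1‖ / 2 * ‖x - y‖ := by
    rw [← norm_smul]
    calc ‖(x - y) • A n 1‖ = ‖(f x - f y) - (f x - f y - (x - y) • A n 1)‖ := by congr 1; abel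
      _ ≤ _ := (norm_sub_le _ _).trans (by gcongr)
  rw [Real.norm_eq_abs] at h2
  linarith

/-- A measurable curve can be made injective without changing its range. -/
lemma exists_injOn_image_eq {f : ℝ → Plane} (hf : Measurable f) {S : Set ℝ} (hS : MeasurableSet S)
    (hd : ∀ x ∈ S, DifferentiableAt ℝ f x) (hd0 : ∀ x ∈ S, deriv f x ≠ 0) :
    ∃ T ⊆ S, MeasurableSet T ∧ InjOn f T ∧ f '' T = f '' S := by
  obtain ⟨P, hPm, rfl, hP⟩ := exists_partition_antilipschitz hS hd hd0
  have hinj : ∀ n, InjOn f (P n) := by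
    intro n x hx y hy hxy
    obtain ⟨c, hc, h⟩ := hP n
    have := h x hx y hy
    rw [hxy, sub_self, norm_zero] at this
    have h2 : |x - y| ≤ 0 := by
      by_contra h3
      push Not at h3
      linarith [mul_pos hc h3]
    exact sub_eq_zero.1 (abs_nonpos_iff.1 h2)
  have himg : ∀ n, MeasurableSet (f '' P n) := fun n =>
    (hPm n).image_of_measurable_injOn hf (hinj n)
  -- A time is kept only if its point is not reached from an earlier piece; `Nat.find` then shows
  -- that no point of the image is lost.
  refine ⟨⋃ n, (P n \ ⋃ k < n, f ⁻¹' (f '' P k)), iUnion_mono fun n => sdiff_subset, ?_, ?_, ?_⟩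
  · exact MeasurableSet.iUnion fun n => (hPm n).diff
      (MeasurableSet.iUnion fun k => MeasurableSet.iUnion fun _ => hf (himg k))
  · intro x hx y hy hxy
    obtain ⟨n, hxn, hxn'⟩ := mem_iUnion.1 hx
    obtain ⟨m, hym, hym'⟩ := mem_iUnion.1 hy
    rcases lt_trichotomy n m with h | rfl | h
    · exact (hym' (mem_iUnion₂_of_mem h ⟨x, hxn, hxy⟩)).elim
    · exact hinj n hxn hym hxy
    · exact (hxn' (mem_iUnion₂_of_mem h ⟨y, hym, hxy.symm⟩)).elim
  · refine (image_mono (iUnion_mono fun n => sdiff_subset)).antisymm ?_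
    rintro _ ⟨x, hx, rfl⟩
    have hex : ∃ n, f x ∈ f '' P n := by
      obtain ⟨n, hn⟩ := mem_iUnion.1 hx
      exact ⟨n, x, hn, rfl⟩
    classical
    obtain ⟨y, hy, hyx⟩ := Nat.find_spec hex
    refine ⟨y, mem_iUnion.2 ⟨Nat.find hex, hy, ?_⟩, hyx⟩
    intro H
    obtain ⟨k, hk, hk'⟩ := mem_iUnion₂.1 H
    exact Nat.find_min hex hk (hyx ▸ hk')

section Concatenation

variable (e : ℤ ≃ ℕ × ℤ) (γ : ℕ → ℝ → Plane)

/-- The curve that runs through the curve `γ i`, restricted to the times in `[k, k + 1)`, during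
the interval `[j, j + 1)`, where `e j = (i, k)`. -/
def concatCurve (t : ℝ) : Plane := γ (e ⌊t⌋).1 (t + ((e ⌊t⌋).2 - ⌊t⌋))

lemma measurable_concatCurve (hγ : ∀ i, Continuous (γ i)) : Measurable (concatCurve e γ) := by
  have h1 : Measurable (fun p : ℕ × ℝ => γ p.1 p.2) :=
    measurable_from_prod_countable_right fun i => (hγ i).measurable
  have h2 : Measurable fun t : ℝ => (e ⌊t⌋) :=
    (Measurable.of_discrete (f := e)).comp Int.measurable_floor
  have h3 : Measurable fun t : ℝ => (((e ⌊t⌋).2 - ⌊t⌋ : ℝ)) :=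
    (Measurable.of_discrete (f := fun j : ℤ => (((e j).2 - j : ℝ)))).comp Int.measurable_floor
  exact h1.comp ((measurable_fst.comp h2).prodMk (measurable_id.add h3))

/-- The floor is locally constant off the integers, so there the concatenation inherits the
differentiability and velocity of its parts. -/
lemma concatCurve_eventuallyEq {t : ℝ} (ht : t ∉ range ((↑) : ℤ → ℝ)) :
    concatCurve e γ =ᶠ[nhds t] fun s => γ (e ⌊t⌋).1 (s + ((e ⌊t⌋).2 - ⌊t⌋)) := by
  have h1 : (⌊t⌋ : ℝ) < t := lt_of_le_of_ne (Int.floor_le t) fun h => ht ⟨_, h⟩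
  filter_upwards [Ioo_mem_nhds h1 (Int.lt_floor_add_one t)] with s hs
  have : ⌊s⌋ = ⌊t⌋ := Int.floor_eq_iff.2 ⟨hs.1.le, hs.2⟩
  rw [concatCurve, this]

lemma exists_concatCurve_eq (i : ℕ) (u : ℝ) : ∃ t, concatCurve e γ t = γ i u := by
  refine ⟨e.symm (i, ⌊u⌋) + Int.fract u, ?_⟩
  have : ⌊(e.symm (i, ⌊u⌋) : ℝ) + Int.fract u⌋ = e.symm (i, ⌊u⌋) := by
    rw [Int.floor_intCast_add, Int.floor_fract, add_zero]
  rw [concatCurve, this, e.apply_symm_apply]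
  congr 1
  have := Int.fract_add_floor u
  linarith

end Concatenation

/-- A measurable rectifiable set is, up to length zero, the image of an injective
parametrization. -/
theorem exists_isParam {B : Set Plane} (hB : MeasurableSet B) (hr : IsRectifiable B) :
    ∃ f T, IsParam f T ∧ f '' T ⊆ B ∧ μH[1] (B \ f '' T) = 0 := by
  obtain ⟨γ, hγ, hB0⟩ := hr
  choose C hC using hγ
  obtain ⟨e⟩ : Nonempty (ℤ ≃ ℕ × ℤ) := nonempty_equiv_of_countable
  set f := concatCurve e γ with hf
  have hfm : Measurable f := measurable_concatCurve e γ fun i => (hC i).continuous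
  set I : Set ℝ := range ((↑) : ℤ → ℝ)
  have hI : I.Countable := countable_range _
  set D : Set ℝ := {t | DifferentiableAt ℝ f t}
  have hD : MeasurableSet D := measurableSet_of_differentiableAt ℝ f
  have hdm : Measurable (deriv f) := measurable_deriv f
  -- The discarded times have images of length zero: the integers are countable, a Lipschitz curve
  -- maps the null set of its nondifferentiability times to a null set, and times of zero velocity
  -- have no length.
  set S : Set ℝ := (Iᶜ ∩ D ∩ deriv f ⁻¹' {0}ᶜ) ∩ f ⁻¹' B with hS
  have hSm : MeasurableSet S := ((hI.measurableSet.compl.inter hD).inter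
    (hdm (measurableSet_singleton _).compl)).inter (hfm hB)
  obtain ⟨T, hTS, hTm, hTi, hTimg⟩ := exists_injOn_image_eq hfm hSm (fun t ht => ht.1.1.2)
    (fun t ht => ht.1.2)
  refine ⟨f, T, ⟨hfm, hTm, hTi, fun t ht => (hTS ht).1.1.2, fun t ht => (hTS ht).1.2, ?_⟩, ?_, ?_⟩
  · intro A ν hν
    -- Translations preserve null sets and there are countably many pieces, so the normality
    -- condition on Lipschitz curves passes to the concatenation, which need not be continuous.
    have h1 : ∀ j : ℤ, ∀ᵐ t : ℝ, γ (e j).1 (t + ((e j).2 - j)) ∈ A →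
        inner ℝ (ν (γ (e j).1 (t + ((e j).2 - j)))) (deriv (γ (e j).1) (t + ((e j).2 - j))) = 0 :=
      fun j => (measurePreserving_add_right volume ((e j).2 - j : ℝ)).quasiMeasurePreserving.ae
        (hν.2 (γ (e j).1) ⟨_, hC _⟩)
    filter_upwards [ae_all_iff.2 h1] with t ht htT htA
    have h2 := concatCurve_eventuallyEq e γ (hTS htT).1.1.1
    have h3 := h2.deriv_eq
    rw [deriv_comp_add_const] at h3
    rw [h3, hf, h2.eq_of_nhds]
    exact ht _ (h2.eq_of_nhds ▸ htA)
  · rw [hTimg]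
    rintro _ ⟨t, ht, rfl⟩
    exact ht.2
  · rw [hTimg]
    have hN : ∀ i, μH[1] (γ i '' {u | ¬ DifferentiableAt ℝ (γ i) u}) = 0 := by
      intro i
      refine le_antisymm (((hC i).hausdorffMeasure_image_le zero_le_one _).trans ?_) zero_le
      rw [hausdorffMeasure_real, ae_iff.1 (hC i).ae_differentiableAt, mul_zero]
    have hI0 : μH[1] (f '' I) = 0 := by
      have : NullSingletonClass (μH[1] : Measure Plane) :=
        Measure.nullSingletonClass_hausdorff _ one_pos
      exact (hI.image f).measure_zero _
    have hZ : μH[1] (f '' (D ∩ deriv f ⁻¹' {0})) = 0 := by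
      have hm : MeasurableSet (D ∩ deriv f ⁻¹' {0}) := hD.inter (hdm (measurableSet_singleton _))
      refine le_antisymm ((hausdorffMeasure_image_le_lintegral hm fun t ht => ht.1).trans ?_)
        zero_le
      rw [setLIntegral_congr_fun (g := fun _ => 0) hm, lintegral_zero]
      intro t ht
      simp [show deriv f t = 0 from ht.2]
    refine measure_mono_null ?_ (measure_union_null hB0 (measure_union_null
      (measure_iUnion_null hN) (measure_union_null hI0 hZ)))
    rintro x ⟨hxB, hxS⟩
    by_cases hx : x ∈ ⋃ i, range (γ i)
    swap
    · exact Or.inl ⟨hxB, hx⟩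
    refine Or.inr ?_
    obtain ⟨i, u, rfl⟩ := mem_iUnion.1 hx
    obtain ⟨t, ht⟩ := exists_concatCurve_eq e γ i u
    rw [← ht] at hxB hxS ⊢
    by_cases htI : t ∈ I
    · exact Or.inr (Or.inl ⟨t, htI, rfl⟩)
    by_cases htD : t ∈ D
    · refine Or.inr (Or.inr ⟨t, ⟨htD, ?_⟩, rfl⟩)
      by_contra h
      exact hxS ⟨t, ⟨⟨⟨htI, htD⟩, h⟩, hxB⟩, rfl⟩
    · refine Or.inl (mem_iUnion.2 ⟨(e ⌊t⌋).1, t + ((e ⌊t⌋).2 - ⌊t⌋), ?_, rfl⟩)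
      intro h
      refine htD ((concatCurve_eventuallyEq e γ htI).differentiableAt_iff.2 ?_)
      exact DifferentiableAt.comp t (f := fun s : ℝ => s + (((e ⌊t⌋).2 : ℝ) - ⌊t⌋)) h (by fun_prop)

/-! ### Existence of the unit normal -/

lemma det_fderiv_real (h : ℝ → ℝ) (x : ℝ) : (fderiv ℝ h x).det = deriv h x := by
  have : fderiv ℝ h x = ContinuousLinearMap.toSpanSingleton ℝ (deriv h x) := by
    ext; simp
  rw [this]; simp

/-- Two curves have parallel velocities where they meet at accumulated times. -/
lemma inner_deriv_eq_zero_of_accPt {f γ : ℝ → Plane} {P : Set ℝ} {c : ℝ} (hc : 0 < c)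
    (hP : ∀ x ∈ P, ∀ y ∈ P, c * |x - y| ≤ ‖f x - f y‖) {s τ : ℝ} (hs : s ∈ P)
    (hf : DifferentiableAt ℝ f s) (hγ : DifferentiableAt ℝ γ τ) (hτ : γ τ = f s)
    (hacc : AccPt τ (Filter.principal (γ ⁻¹' (f '' P)))) {w : Plane}
    (hw : inner ℝ w (deriv f s) = 0) : inner ℝ w (deriv γ τ) = 0 := by
  classical
  set S := γ ⁻¹' (f '' P)
  have hex : ∀ t, ∃ u, t ∈ S → u ∈ P ∧ f u = γ t := by
    intro t
    by_cases ht : t ∈ S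
    · obtain ⟨u, hu, h⟩ := ht
      exact ⟨u, fun _ => ⟨hu, h⟩⟩
    · exact ⟨0, fun h => absurd h ht⟩
  choose σ hσ using hex
  -- `σ` lifts times of `γ` in `S` to times of `f`. Expansion of `f` on `P` gives `σ t - s = O(t -
  -- τ)`, so the first-order expansion of `f` at `s` also describes `γ` along `S`.
  have hO : (fun t => σ t - s) =O[nhdsWithin τ S] fun t => t - τ := by
    have h1 : (fun t => σ t - s) =O[nhdsWithin τ S] fun t => γ t - γ τ := by
      refine Asymptotics.IsBigO.of_bound c⁻¹ ?_
      filter_upwards [self_mem_nhdsWithin] with t ht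
      have := hP _ (hσ t ht).1 s hs
      rw [(hσ t ht).2, ← hτ] at this
      rw [inv_mul_eq_div, le_div_iff₀ hc, mul_comm]
      exact this
    exact h1.trans (hγ.hasDerivAt.isBigO_sub.mono nhdsWithin_le_nhds)
  have hlim : Filter.Tendsto σ (nhdsWithin τ S) (nhds s) := by
    have h1 : Filter.Tendsto (fun t => t - τ) (nhdsWithin τ S) (nhds 0) := by
      have : Filter.Tendsto (fun t => t - τ) (nhds τ) (nhds (τ - τ)) :=
        (continuous_id.sub continuous_const).tendsto τ
      rw [sub_self] at this
      exact this.mono_left nhdsWithin_le_nhds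
    have h2 := hO.trans_tendsto h1
    simpa using h2.add_const s
  have ho : (fun t => f (σ t) - f s - (σ t - s) • deriv f s) =o[nhdsWithin τ S] fun t => t - τ :=
    ((hasDerivAt_iff_isLittleO.1 hf.hasDerivAt).comp_tendsto hlim).trans_isBigO hO
  have h0 : HasDerivWithinAt (fun t => inner ℝ w (γ t)) 0 S τ := by
    rw [hasDerivWithinAt_iff_isLittleO]
    refine Asymptotics.IsBigO.trans_isLittleO (Asymptotics.IsBigO.of_bound ‖w‖ ?_) ho
    filter_upwards [self_mem_nhdsWithin] with t ht
    refine le_of_eq_of_le (congrArg norm ?_) (norm_inner_le_norm (𝕜 := ℝ) w _)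
    rw [(hσ t ht).2, ← hτ, inner_sub_right, inner_sub_right, inner_smul_right, hw]
    simp
  have h1 : HasDerivWithinAt (fun t => inner ℝ w (γ t)) (inner ℝ w (deriv γ τ)) S τ :=
    ((innerSL ℝ w).hasFDerivAt.comp_hasDerivAt τ hγ.hasDerivAt).hasDerivWithinAt
  exact hacc.uniqueDiffWithinAt.eq_deriv _ h1 h0

/-- A Lipschitz curve is at rest at almost every time that it spends in a set of length zero. -/
lemma LipschitzWith.ae_deriv_eq_zero_of_mem {γ : ℝ → Plane} {C : ℝ≥0} (hγ : LipschitzWith C γ)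
    {Z : Set Plane} (hZ : MeasurableSet Z) (hZ0 : μH[1] Z = 0) :
    ∀ᵐ t : ℝ, γ t ∈ Z → deriv γ t = 0 := by
  set T : Set ℝ := {t | DifferentiableAt ℝ γ t} ∩ γ ⁻¹' Z
  have hT : MeasurableSet T := (measurableSet_of_differentiableAt ℝ γ).inter
    (hγ.continuous.measurable hZ)
  -- Each coordinate maps `T` into a null set of reals, so its derivative vanishes almost everywhere
  -- on `T` by the area formula.
  have hcoord : ∀ k : Fin 2, ∀ᵐ t : ℝ, t ∈ T → deriv γ t k = 0 := by
    intro k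
    have hd : ∀ t ∈ T, HasDerivAt (fun t => γ t k) (deriv γ t k) t := fun t ht =>
      (EuclideanSpace.proj k : Plane →L[ℝ] ℝ).hasFDerivAt.comp_hasDerivAt t
        ht.1.hasDerivAt
    have hlip : LipschitzWith 1 fun x : Plane => x k :=
      LipschitzWith.of_dist_le_mul fun x y => by
        rw [NNReal.coe_one, one_mul, dist_eq_norm, dist_eq_norm]
        exact PiLp.norm_apply_le (x - y) k
    have hnull : volume ((fun t => γ t k) '' T) = 0 := by
      rw [← hausdorffMeasure_real]
      refine le_antisymm ((measure_mono ?_).trans ((hlip.hausdorffMeasure_image_le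
        zero_le_one Z).trans ?_)) zero_le
      · rintro _ ⟨t, ht, rfl⟩
        exact ⟨γ t, ht.2, rfl⟩
      · rw [hZ0, mul_zero]
    have h1 := ae_det_eq_zero_or_of_ae volume (h := fun t => γ t k)
      (hlip.continuous.comp hγ.continuous).measurable hT
      (fun t ht => (hd t ht).differentiableAt) (measure_eq_zero_iff_ae_notMem.1 hnull)
    rw [ae_restrict_iff' hT] at h1
    filter_upwards [h1] with t ht htT
    rcases ht htT with h | h
    · rw [det_fderiv_real, (hd t htT).deriv] at h
      exact h
    · exact absurd ⟨t, htT, rfl⟩ h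
  filter_upwards [hγ.ae_differentiableAt, ae_all_iff.2 hcoord] with t ht1 ht2 htZ
  ext k
  exact ht2 k ⟨ht1, htZ⟩

/-- Rotation by a right angle. -/
def rotate (v : Plane) : Plane := !₂[-v 1, v 0]

lemma inner_eq (v w : Plane) : inner ℝ v w = v 0 * w 0 + v 1 * w 1 := by
  simp [PiLp.inner_apply, Fin.sum_univ_two, mul_comm]

lemma norm_sq_eq (v : Plane) : ‖v‖ ^ 2 = v 0 ^ 2 + v 1 ^ 2 := by
  rw [← real_inner_self_eq_norm_sq, inner_eq]; ring

lemma inner_rotate_self (v : Plane) : inner ℝ (rotate v) v = 0 := by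
  rw [inner_eq]; simp [rotate]; ring

lemma norm_rotate (v : Plane) : ‖rotate v‖ = ‖v‖ := by
  rw [← sq_eq_sq₀ (norm_nonneg _) (norm_nonneg _), norm_sq_eq, norm_sq_eq]
  simp [rotate]; ring

/-- The normal is the rotated unit velocity of the parametrization. Another Lipschitz curve is
parallel to `f` at almost every time when it meets the image, and at rest at almost every time spent
in the null remainder. Off the image any unit vector serves. -/
theorem exists_isUnitNormalField {f : ℝ → Plane} {T : Set ℝ} (hp : IsParam f T) {A : Set Plane}
    (hA : μH[1] (A \ f '' T) = 0) : ∃ ν, IsUnitNormalField A ν := by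
  classical
  obtain ⟨P, hPm, hPT, hP⟩ := exists_partition_antilipschitz hp.measurableSet hp.differentiableAt
    hp.deriv_ne_zero
  let d : Plane → Plane := fun x => deriv f (Function.invFunOn f T x)
  refine ⟨fun x => if x ∈ f '' T then ‖d x‖⁻¹ • rotate (d x) else !₂[1, 0], fun x => ?_, ?_⟩
  · by_cases hx : x ∈ f '' T
    · have h1 : d x ≠ 0 := hp.deriv_ne_zero _ (Function.invFunOn_mem hx)
      simp only [hx, if_true]
      rw [norm_smul, norm_inv, norm_norm, norm_rotate, inv_mul_cancel₀ (norm_ne_zero_iff.2 h1)]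
    · simp only [hx, if_false]
      rw [← sq_eq_sq₀ (norm_nonneg _) zero_le_one, norm_sq_eq]
      simp
  · rintro γ ⟨C, hγ⟩
    have hZ0 : μH[1] (toMeasurable μH[1] (A \ f '' T)) = 0 := by rw [measure_toMeasurable, hA]
    filter_upwards [hγ.ae_differentiableAt,
      hγ.ae_deriv_eq_zero_of_mem (measurableSet_toMeasurable _ _) hZ0,
      ae_all_iff.2 fun n => ae_accPt (γ ⁻¹' (f '' P n))] with t h1 h2 h3 htA
    by_cases ht : γ t ∈ f '' T
    · obtain ⟨s, hs, hst⟩ := ht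
      have hd : d (γ t) = deriv f s := by
        simp only [d]
        rw [← hst, hp.injOn.leftInvOn_invFunOn hs]
      rw [if_pos ⟨s, hs, hst⟩, hd, inner_smul_left]
      obtain ⟨n, hn⟩ := mem_iUnion.1 (hPT ▸ hs : s ∈ ⋃ n, P n)
      obtain ⟨c, hc, hc'⟩ := hP n
      rw [inner_deriv_eq_zero_of_accPt hc hc' hn (hp.differentiableAt s hs) h1 hst.symm
        (h3 n ⟨s, hn, hst⟩) (inner_rotate_self _), mul_zero]
    · rw [h2 (subset_toMeasurable _ _ ⟨htA, ht⟩), inner_zero_right]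

/-- This excludes the default value `0` in `unitNormal`. -/
lemma isUnitNormalField_unitNormal {f : ℝ → Plane} {T : Set ℝ} (hp : IsParam f T) {A : Set Plane}
    (hA : μH[1] (A \ f '' T) = 0) : IsUnitNormalField A (unitNormal A) := by
  have h := exists_isUnitNormalField hp hA
  rw [unitNormal, dif_pos h]
  exact h.choose_spec

/-! ### Lines in the plane -/

/-- The intercept of the line of slope `m` through `x`. -/
def lineForm (m : ℝ) (x : Plane) : ℝ := x 1 - m * x 0

/-- `lineForm` as a continuous linear map. -/
def lineFormL (m : ℝ) : Plane →L[ℝ] ℝ :=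
  (EuclideanSpace.proj 1 : Plane →L[ℝ] ℝ) - m • (EuclideanSpace.proj 0 : Plane →L[ℝ] ℝ)

lemma coe_lineFormL (m : ℝ) : ⇑(lineFormL m) = lineForm m := rfl

/-- The density of the invariant measure on lines, parametrized by slope and intercept. -/
def lineDensity (m : ℝ) : ℝ := (√(1 + m ^ 2) ^ 3)⁻¹

lemma continuous_lineDensity : Continuous lineDensity := by
  refine Continuous.inv₀ (by fun_prop) fun m => ?_
  have : 0 < √(1 + m ^ 2) := Real.sqrt_pos.2 (by positivity)
  positivity

lemma lineDensity_nonneg (m : ℝ) : 0 ≤ lineDensity m := by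
  unfold lineDensity; positivity

/-- The primitive is the scalar product of `(a, b)` with the unit vector of slope `m`. -/
lemma hasDerivAt_lineDensity_primitive (a b m : ℝ) :
    HasDerivAt (fun m => (b * m + a) / √(1 + m ^ 2)) (lineDensity m * (b - m * a)) m := by
  have h0 : 0 < 1 + m ^ 2 := by positivity
  have h1 : HasDerivAt (fun m : ℝ => 1 + m ^ 2) (2 * m) m := by
    simpa using (hasDerivAt_pow 2 m).const_add 1
  have h2 := h1.sqrt h0.ne'
  have h3 : HasDerivAt (fun m : ℝ => b * m + a) b m := by
    simpa using ((hasDerivAt_id m).const_mul b).add_const a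
  have hs : 0 < √(1 + m ^ 2) := Real.sqrt_pos.2 h0
  have hs2 : √(1 + m ^ 2) ^ 2 = 1 + m ^ 2 := Real.sq_sqrt h0.le
  refine (h3.div h2 hs.ne').congr_deriv ?_
  unfold lineDensity
  field_simp
  rw [hs2]
  ring

lemma tendsto_lineDensity_primitive (a b : ℝ) :
    Filter.Tendsto (fun m => (b * m + a) / √(1 + m ^ 2)) Filter.atTop (nhds b) := by
  have h1 : Filter.Tendsto (fun m : ℝ => (b + a * m⁻¹) / √(m⁻¹ ^ 2 + 1)) Filter.atTop
      (nhds ((b + a * 0) / √(0 ^ 2 + 1))) := by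
    have h := tendsto_inv_atTop_zero (𝕜 := ℝ)
    refine ((h.const_mul a).const_add b).div (((h.pow 2).add_const 1).sqrt) ?_
    simp
  rw [show (b + a * 0) / √(0 ^ 2 + 1) = b by simp] at h1
  refine h1.congr' ?_
  filter_upwards [Filter.eventually_gt_atTop 0] with m hm
  have h2 : √(1 + m ^ 2) = m * √(m⁻¹ ^ 2 + 1) := by
    rw [show 1 + m ^ 2 = m ^ 2 * (m⁻¹ ^ 2 + 1) by field_simp,
      Real.sqrt_mul (by positivity), Real.sqrt_sq hm.le]
  have h3 : 0 < √(m⁻¹ ^ 2 + 1) := Real.sqrt_pos.2 (by positivity)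
  rw [h2]
  field_simp

/-- Without a sign change, the fundamental theorem of calculus on a half-line applies. The
nonnegativity of the value is needed to add two such integrals under `ENNReal.ofReal`. -/
lemma setLIntegral_lineDensity_mul {a b m₀ : ℝ} (h : ∀ m > m₀, 0 ≤ b - m * a) :
    0 ≤ b - (b * m₀ + a) / √(1 + m₀ ^ 2) ∧
    ∫⁻ m in Ioi m₀, ENNReal.ofReal (lineDensity m * |b - m * a|) =
      ENNReal.ofReal (b - (b * m₀ + a) / √(1 + m₀ ^ 2)) := by
  have hpos : ∀ m ∈ Ioi m₀, 0 ≤ lineDensity m * (b - m * a) := fun m hm =>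
    mul_nonneg (lineDensity_nonneg m) (h m hm)
  have hintegral := integrableOn_Ioi_deriv_of_nonneg' (a := m₀)
    (fun m _ => hasDerivAt_lineDensity_primitive a b m) hpos (tendsto_lineDensity_primitive a b)
  have hval := integral_Ioi_of_hasDerivAt_of_nonneg' (a := m₀)
    (fun m _ => hasDerivAt_lineDensity_primitive a b m) hpos (tendsto_lineDensity_primitive a b)
  refine ⟨hval ▸ setIntegral_nonneg measurableSet_Ioi hpos, ?_⟩
  rw [← hval, ofReal_integral_eq_lintegral_ofReal hintegral]
  · refine setLIntegral_congr_fun measurableSet_Ioi fun m hm => ?_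
    rw [abs_of_nonneg (h m hm)]
  · exact (ae_restrict_iff' measurableSet_Ioi).2 (Filter.Eventually.of_forall hpos)

lemma lineDensity_neg (m : ℝ) : lineDensity (-m) = lineDensity m := by simp [lineDensity]

lemma lintegral_eq_add_Ioi_neg (F : ℝ → ℝ≥0∞) (m₀ : ℝ) :
    ∫⁻ m, F m = (∫⁻ m in Ioi m₀, F m) + ∫⁻ m in Ioi (-m₀), F (-m) := by
  rw [← lintegral_add_compl F (measurableSet_Ioi (a := m₀)), compl_Ioi,
    setLIntegral_congr (Iio_ae_eq_Iic (a := m₀)).symm]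
  congr 1
  have h := (Measure.measurePreserving_neg (volume : Measure ℝ)).setLIntegral_comp_preimage_emb
    (MeasurableEquiv.neg ℝ).measurableEmbedding F (Iio m₀)
  rw [← h]
  congr 2
  ext x
  simp

/-- The integrand changes sign at `m = b / a`. The two sides contribute `√(a² + b²) + b` and `√(a² +
b²) - b`. -/
lemma lintegral_lineDensity_mul_of_neg {a b : ℝ} (ha : a < 0) :
    ∫⁻ m, ENNReal.ofReal (lineDensity m * |b - m * a|) =
      ENNReal.ofReal (2 * √(a ^ 2 + b ^ 2)) := by
  rw [lintegral_eq_add_Ioi_neg _ (b / a)]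
  simp_rw [lineDensity_neg]
  have h2 : ∀ m : ℝ, |b - -m * a| = |-b - m * a| := fun m => by
    rw [← abs_neg]; congr 1; ring
  simp_rw [h2]
  have hr : ∀ m > b / a, 0 ≤ b - m * a := fun m hm => by
    rw [gt_iff_lt, div_lt_iff_of_neg ha] at hm
    linarith
  have hl : ∀ m > -(b / a), 0 ≤ -b - m * a := fun m hm => by
    rw [gt_iff_lt, neg_lt, lt_div_iff_of_neg ha] at hm
    linarith
  have hr' := setLIntegral_lineDensity_mul hr
  have hl' := setLIntegral_lineDensity_mul hl
  rw [hr'.2, hl'.2, ← ENNReal.ofReal_add hr'.1 hl'.1]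
  congr 1
  have h0 : (0 : ℝ) ≤ 1 + (b / a) ^ 2 := by positivity
  have hs : 0 < √(1 + (b / a) ^ 2) := Real.sqrt_pos.2 (by positivity)
  have h4 : a ^ 2 * (1 + (b / a) ^ 2) = a ^ 2 + b ^ 2 := by
    rw [div_pow, mul_add, mul_one, mul_div_cancel₀ _ (pow_ne_zero 2 ha.ne)]
  have h3 : √(a ^ 2 + b ^ 2) = -a * √(1 + (b / a) ^ 2) := by
    rw [← h4, ← neg_sq a, Real.sqrt_mul (by positivity), Real.sqrt_sq (by linarith)]
  have hab : b * (b / a) + a = a * √(1 + (b / a) ^ 2) ^ 2 := by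
    rw [Real.sq_sqrt h0]
    have := ha.ne
    field_simp
    ring
  rw [h3, neg_sq, show -b * -(b / a) + a = b * (b / a) + a by ring, hab]
  field_simp
  ring

lemma lintegral_lineDensity_mul_of_zero {b : ℝ} (hb : 0 ≤ b) :
    ∫⁻ m, ENNReal.ofReal (lineDensity m * |b - m * 0|) = ENNReal.ofReal (2 * b) := by
  rw [lintegral_eq_add_Ioi_neg _ 0]
  simp_rw [lineDensity_neg, mul_zero]
  have h1 := setLIntegral_lineDensity_mul (a := 0) (b := b) (m₀ := 0)
    fun m _ => by simpa using hb
  simp only [mul_zero, add_zero, zero_div, sub_zero] at h1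
  rw [sub_zero, neg_zero, h1.2, ← ENNReal.ofReal_add hb hb, two_mul]

/-- The measure of the lines that meet a segment is twice its length. -/
theorem lintegral_lineDensity_mul_lineForm (v : Plane) :
    ∫⁻ m, ENNReal.ofReal (lineDensity m * |lineForm m v|) = 2 * ‖v‖ₑ := by
  have hgen : ∀ a b : ℝ, ∫⁻ m, ENNReal.ofReal (lineDensity m * |b - m * a|) =
      ENNReal.ofReal (2 * √(a ^ 2 + b ^ 2)) := by
    intro a b
    have hneg : ∀ m, |b - m * a| = |-b - m * -a| := fun m => by rw [← abs_neg]; congr 1; ring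
    rcases lt_trichotomy a 0 with ha | rfl | ha
    · exact lintegral_lineDensity_mul_of_neg ha
    · rcases le_total 0 b with hb | hb
      · rw [lintegral_lineDensity_mul_of_zero hb, zero_pow two_ne_zero, zero_add,
          Real.sqrt_sq hb]
      · simp_rw [hneg]
        rw [neg_zero, lintegral_lineDensity_mul_of_zero (neg_nonneg.2 hb), zero_pow two_ne_zero,
          zero_add, ← neg_sq b, Real.sqrt_sq (neg_nonneg.2 hb)]
    · simp_rw [hneg]
      rw [lintegral_lineDensity_mul_of_neg (neg_lt_zero.2 ha), neg_sq, neg_sq]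
  have h2 : √(v 0 ^ 2 + v 1 ^ 2) = ‖v‖ := by rw [← norm_sq_eq, Real.sqrt_sq (norm_nonneg v)]
  simp only [lineForm]
  rw [hgen, h2, ENNReal.ofReal_mul zero_le_two, ofReal_norm]
  simp

/-! ### Moments of the number of crossings of a parametrized set with lines -/

section Crossings

variable {f : ℝ → Plane} {T : Set ℝ}

/-- A pair of a slope and a time, mapped to the line of that slope through the point at that
time. -/
def lineThrough (f : ℝ → Plane) (p : ℝ × ℝ) : ℝ × ℝ := (p.1, lineForm p.1 (f p.2))

lemma measurable_coord {f : ℝ → Plane} (hf : Measurable f) (k : Fin 2) :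
    Measurable fun t => f t k :=
  (EuclideanSpace.proj k : Plane →L[ℝ] ℝ).continuous.measurable.comp hf

lemma HasDerivAt.coord {f : ℝ → Plane} {v : Plane} {t : ℝ} (h : HasDerivAt f v t) (k : Fin 2) :
    HasDerivAt (fun t => f t k) (v k) t :=
  (EuclideanSpace.proj k : Plane →L[ℝ] ℝ).hasFDerivAt.comp_hasDerivAt t h

lemma measurable_lineThrough (hf : Measurable f) : Measurable (lineThrough f) := by
  have h0 := measurable_coord hf 0
  have h1 := measurable_coord hf 1
  unfold lineThrough lineForm
  fun_prop

lemma hasFDerivAt_lineThrough {p : ℝ × ℝ} (hd : DifferentiableAt ℝ f p.2) :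
    HasFDerivAt (lineThrough f) (LinearMap.toContinuousLinearMap
      (Matrix.toLin (Module.Basis.finTwoProd ℝ) (Module.Basis.finTwoProd ℝ)
        !![1, 0; -(f p.2 0), lineForm p.1 (deriv f p.2)])) p := by
  rw [Matrix.toLin_finTwoProd_toContinuousLinearMap]
  have h0 := (hd.hasDerivAt.coord 0).comp_hasFDerivAt p
    (hasFDerivAt_snd (𝕜 := ℝ) (E := ℝ) (F := ℝ))
  have h1 := (hd.hasDerivAt.coord 1).comp_hasFDerivAt p
    (hasFDerivAt_snd (𝕜 := ℝ) (E := ℝ) (F := ℝ))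
  have h := (hasFDerivAt_fst (𝕜 := ℝ) (p := p)).prodMk (h1.sub (hasFDerivAt_fst.mul h0))
  refine h.congr_fderiv ?_
  ext <;> simp [lineForm]

/-- The slope is kept, so the matrix is triangular and its determinant is the speed at which the
intercept changes. -/
lemma det_fderiv_lineThrough {p : ℝ × ℝ} (hd : DifferentiableAt ℝ f p.2) :
    (fderiv ℝ (lineThrough f) p).det = lineForm p.1 (deriv f p.2) := by
  rw [(hasFDerivAt_lineThrough hd).fderiv]
  simp only [LinearMap.det_toContinuousLinearMap, LinearMap.det_toLin, Matrix.det_fin_two_of]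
  ring

/-- The number of crossings, weighted by `ϑ`, of the parametrized set with the line of slope `p.1`
and intercept `p.2`. -/
def paramCrossings (f : ℝ → Plane) (T : Set ℝ) (ϑ : ℝ → ℝ≥0∞) (p : ℝ × ℝ) : ℝ≥0∞ :=
  fiberSum (fun t => lineForm p.1 (f t)) T ϑ p.2

lemma fiberSum_lineThrough (ϑ : ℝ → ℝ≥0∞) (p : ℝ × ℝ) :
    fiberSum (lineThrough f) (univ ×ˢ T) (fun q => ϑ q.2) p = paramCrossings f T ϑ p := by
  rw [paramCrossings, fiberSum, fiberSum, ENNReal.tsum_prod', tsum_eq_single p.1]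
  · refine tsum_congr fun t => ?_
    by_cases h : t ∈ T ∩ (fun t => lineForm p.1 (f t)) ⁻¹' {p.2}
    · rw [indicator_of_mem h, indicator_of_mem]
      exact ⟨⟨mem_univ _, h.1⟩, Prod.ext rfl h.2⟩
    · rw [indicator_of_notMem h, indicator_of_notMem]
      exact fun H => h ⟨H.1.2, congrArg Prod.snd H.2⟩
  · intro m hm
    refine ENNReal.tsum_eq_zero.2 fun t => indicator_of_notMem ?_ _
    exact fun H => hm (congrArg Prod.fst H.2)

lemma aemeasurable_paramCrossings (hp : IsParam f T) {ϑ : ℝ → ℝ≥0∞} (hϑ : Measurable ϑ) :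
    AEMeasurable (paramCrossings f T ϑ) := by
  have h := (area_formula (volume : Measure (ℝ × ℝ)) (h := lineThrough f)
    (MeasurableSet.univ.prod hp.measurableSet)
    (fun p hp' => (hasFDerivAt_lineThrough (hp.differentiableAt _ hp'.2)).differentiableAt)
    (hϑ.comp measurable_snd)).1
  exact h.congr (Filter.Eventually.of_forall fun p => fiberSum_lineThrough ϑ p)

/-- Integration over lines of a function weighted by the number of crossings. -/
lemma lintegral_mul_paramCrossings (hp : IsParam f T) {ϑ : ℝ → ℝ≥0∞} (hϑ : Measurable ϑ)
    {G : ℝ × ℝ → ℝ≥0∞} (hG : Measurable G) :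
    ∫⁻ p, G p * paramCrossings f T ϑ p =
      ∫⁻ t in T, ϑ t * ∫⁻ m, ENNReal.ofReal |lineForm m (deriv f t)| * G (m, lineForm m (f t)) := by
  have hm := measurable_lineThrough hp.measurable
  have hS : MeasurableSet ((univ : Set ℝ) ×ˢ T) := MeasurableSet.univ.prod hp.measurableSet
  have h := (area_formula (volume : Measure (ℝ × ℝ)) (h := lineThrough f) hS
    (fun p hp' => (hasFDerivAt_lineThrough (hp.differentiableAt _ hp'.2)).differentiableAt)
    ((hG.comp hm).mul (hϑ.comp measurable_snd))).2
  have h1 : ∀ p, G p * paramCrossings f T ϑ p = fiberSum (lineThrough f) (univ ×ˢ T)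
      ((G ∘ lineThrough f) * (ϑ ∘ Prod.snd)) p := fun p => by
    rw [← fiberSum_lineThrough, ← fiberSum_mul_comp]; rfl
  have hdm : Measurable (deriv f) := measurable_deriv f
  have hd0 := measurable_coord hdm 0
  have hd1 := measurable_coord hdm 1
  have h2 : Measurable fun p : ℝ × ℝ => ENNReal.ofReal |lineForm p.1 (deriv f p.2)| *
      (G (lineThrough f p) * ϑ p.2) := by
    have : Measurable fun p : ℝ × ℝ => lineForm p.1 (deriv f p.2) := by
      unfold lineForm; fun_prop
    exact this.abs.ennreal_ofReal.mul ((hG.comp hm).mul (hϑ.comp measurable_snd))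
  simp_rw [h1]
  rw [h, setLIntegral_congr_fun (g := fun p => ENNReal.ofReal |lineForm p.1 (deriv f p.2)| *
      (G (lineThrough f p) * ϑ p.2)) hS]
  · rw [Measure.volume_eq_prod, ← Measure.prod_restrict, Measure.restrict_univ,
      lintegral_prod_symm _ h2.aemeasurable]
    refine lintegral_congr fun t => ?_
    rw [← lintegral_const_mul]
    · refine lintegral_congr fun m => ?_
      simp only [lineThrough]
      ring
    · have h3 : Measurable fun m => lineForm m (deriv f t) := by unfold lineForm; fun_prop
      have h4 : Measurable fun m => lineForm m (f t) := by unfold lineForm; fun_prop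
      exact h3.abs.ennreal_ofReal.mul (hG.comp (measurable_id.prodMk h4))
  · intro p hp'
    simp only [Pi.mul_apply, Function.comp_apply]
    rw [det_fderiv_lineThrough (hp.differentiableAt _ hp'.2)]

lemma measurable_lineDensity : Measurable lineDensity := continuous_lineDensity.measurable

/-- The first moment of the number of crossings. -/
lemma lintegral_paramCrossings (hp : IsParam f T) {ϑ : ℝ → ℝ≥0∞} (hϑ : Measurable ϑ) :
    ∫⁻ p : ℝ × ℝ, ENNReal.ofReal (lineDensity p.1) * paramCrossings f T ϑ p =
      ∫⁻ t in T, ϑ t * (2 * ‖deriv f t‖ₑ) := by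
  rw [lintegral_mul_paramCrossings hp hϑ (G := fun p => ENNReal.ofReal (lineDensity p.1))
    (measurable_lineDensity.comp measurable_fst).ennreal_ofReal]
  refine lintegral_congr fun t => ?_
  rw [← lintegral_lineDensity_mul_lineForm]
  congr 1
  refine lintegral_congr fun m => ?_
  rw [mul_comm, ENNReal.ofReal_mul (lineDensity_nonneg m)]

/-- The oriented area spanned by two vectors. -/
def cross (u v : Plane) : ℝ := u 0 * v 1 - u 1 * v 0

/-- The pair interaction in terms of the velocities. -/
def paramKernel (f : ℝ → Plane) (t s : ℝ) : ℝ :=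
  |cross (deriv f t) (f s - f t)| * |cross (deriv f s) (f s - f t)| / ‖f s - f t‖ ^ 3

/-- The slope of the line through the points at times `t` and `s`. -/
def chordSlope (f : ℝ → Plane) (t s : ℝ) : ℝ := (f s 1 - f t 1) / (f s 0 - f t 0)

/-- On a line through `f t`, the crossings are `t` itself and the times whose chord from `f t` has
slope `m`. By injectivity of `f` no other time of `T` sits at `f t`. This splits the second moment
into coincident and distinct pairs. -/
lemma paramCrossings_lineThrough (hp : IsParam f T) (ϑ : ℝ → ℝ≥0∞) {t : ℝ} (ht : t ∈ T) (m : ℝ) :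
    paramCrossings f T ϑ (m, lineForm m (f t)) =
      ϑ t + fiberSum (chordSlope f t) (T ∩ {s | f s 0 ≠ f t 0}) ϑ m := by
  have h1 : T = {t} ∪ (T \ {t}) := by
    rw [union_sdiff_self, union_eq_right.2 (singleton_subset_iff.2 ht)]
  rw [paramCrossings, h1, fiberSum_union disjoint_sdiff_right, ← h1]
  congr 1
  · exact fiberSum_apply_of_injOn (h := fun s => lineForm m (f s)) (injOn_singleton _ _) ϑ
      (mem_singleton t)
  · refine tsum_congr fun s => ?_
    congr 1
    ext s
    simp only [mem_inter_iff, mem_sdiff, mem_singleton_iff, mem_preimage, mem_ofPred_eq, chordSlope,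
      lineForm]
    constructor
    · rintro ⟨⟨hs, hst⟩, h⟩
      have h0 : f s 0 ≠ f t 0 := by
        intro h0
        refine hst (hp.injOn hs ht ?_)
        ext k
        fin_cases k
        · exact h0
        · have : f s 1 = f t 1 := by rw [h0] at h; linarith
          exact this
      refine ⟨⟨hs, h0⟩, ?_⟩
      rw [div_eq_iff (sub_ne_zero.2 h0)]
      linarith
    · rintro ⟨⟨hs, h0⟩, h⟩
      refine ⟨⟨hs, fun hst => h0 (by rw [hst])⟩, ?_⟩
      rw [div_eq_iff (sub_ne_zero.2 h0)] at h
      linarith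

lemma hasDerivAt_chordSlope {t s : ℝ} (hd : DifferentiableAt ℝ f s) (h0 : f s 0 ≠ f t 0) :
    HasDerivAt (chordSlope f t)
      (-cross (deriv f s) (f s - f t) / (f s 0 - f t 0) ^ 2) s := by
  have h := ((hd.hasDerivAt.coord 1).sub_const (f t 1)).div
    ((hd.hasDerivAt.coord 0).sub_const (f t 0)) (sub_ne_zero.2 h0)
  refine h.congr_deriv ?_
  simp only [cross, PiLp.sub_apply]
  ring

/-- The density at the slope of `w` is `(|w 0| / ‖w‖)³`. Its numerator cancels the `(w 0)²` from the
derivative of the chord slope and the `w 0` from `lineForm`, which leaves the kernel. -/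
lemma lineDensity_mul_eq {u v w : Plane} (hw : w 0 ≠ 0) :
    |-cross u w / w 0 ^ 2| * (lineDensity (w 1 / w 0) * |lineForm (w 1 / w 0) v|) =
      |cross v w| * |cross u w| / ‖w‖ ^ 3 := by
  have h1 : √(1 + (w 1 / w 0) ^ 2) = ‖w‖ / |w 0| := by
    rw [← Real.sqrt_sq (norm_nonneg w), norm_sq_eq, ← Real.sqrt_sq_eq_abs, ← Real.sqrt_div
      (by positivity)]
    congr 1
    field_simp
  have h2 : lineForm (w 1 / w 0) v = -cross v w / w 0 := by
    simp only [lineForm, cross]; field_simp; ring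
  have h3 : ‖w‖ ≠ 0 := norm_ne_zero_iff.2 fun h => hw (by simp [h])
  have h4 : |w 0| ≠ 0 := abs_ne_zero.2 hw
  rw [lineDensity, h1, h2]
  simp only [abs_div, abs_neg, abs_pow]
  field_simp

/-- At almost all times on a vertical line the velocity is vertical. Hence vertical chords, which
have no slope, carry no interaction. -/
lemma ae_deriv_coord_eq_zero (hp : IsParam f T) (c : ℝ) :
    ∀ᵐ s : ℝ, s ∈ T → f s 0 = c → deriv f s 0 = 0 := by
  have h := ae_det_eq_zero_or_of_ae volume (h := fun s => f s 0) (measurable_coord hp.measurable 0)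
    hp.measurableSet (fun s hs => ((hp.differentiableAt s hs).hasDerivAt.coord 0).differentiableAt)
    (P := fun y => y ≠ c) (measure_eq_zero_iff_ae_notMem.1 (measure_singleton c))
  rw [ae_restrict_iff' hp.measurableSet] at h
  filter_upwards [h] with s hs hsT hsc
  rcases hs hsT with h1 | h1
  · rwa [det_fderiv_real, ((hp.differentiableAt s hsT).hasDerivAt.coord 0).deriv] at h1
  · exact absurd hsc h1

/-- For a fixed first point, this is the change of variables from the slope to the time of the
second point. -/
lemma lintegral_fiberSum_chordSlope (hp : IsParam f T) {ϑ : ℝ → ℝ≥0∞} (hϑ : Measurable ϑ) (t : ℝ) :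
    ∫⁻ m, ENNReal.ofReal (lineDensity m * |lineForm m (deriv f t)|) *
        fiberSum (chordSlope f t) (T ∩ {s | f s 0 ≠ f t 0}) ϑ m =
      ∫⁻ s in T, ϑ s * ENNReal.ofReal (paramKernel f t s) := by
  have hf0 := measurable_coord hp.measurable 0
  have hf1 := measurable_coord hp.measurable 1
  have hD : MeasurableSet {s | f s 0 ≠ f t 0} := hf0 (measurableSet_singleton (f t 0)).compl
  have hS := hp.measurableSet.inter hD
  have hm : Measurable (chordSlope f t) := (hf1.sub_const _).div (hf0.sub_const _)
  have hGm : Measurable fun m => ENNReal.ofReal (lineDensity m * |lineForm m (deriv f t)|) := by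
    have h4 : Measurable fun m => lineForm m (deriv f t) := by unfold lineForm; fun_prop
    exact (measurable_lineDensity.mul h4.abs).ennreal_ofReal
  have h := (area_formula (volume : Measure ℝ) hS
    (fun s hs => (hasDerivAt_chordSlope (hp.differentiableAt s hs.1) hs.2).differentiableAt)
    ((hGm.comp hm).mul hϑ)).2
  have h1 : ∀ m, ENNReal.ofReal (lineDensity m * |lineForm m (deriv f t)|) *
      fiberSum (chordSlope f t) (T ∩ {s | f s 0 ≠ f t 0}) ϑ m =
      fiberSum (chordSlope f t) (T ∩ {s | f s 0 ≠ f t 0}) (((fun m => ENNReal.ofReal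
        (lineDensity m * |lineForm m (deriv f t)|)) ∘ chordSlope f t) * ϑ) m := fun m => by
    rw [← fiberSum_mul_comp _ _ (fun m => ENNReal.ofReal
      (lineDensity m * |lineForm m (deriv f t)|))]; rfl
  simp_rw [h1]
  rw [h, ← lintegral_inter_add_sdiff _ T hD]
  have hzero : ∫⁻ s in T \ {s | f s 0 ≠ f t 0}, ϑ s * ENNReal.ofReal (paramKernel f t s) = 0 := by
    rw [setLIntegral_congr_fun_ae (g := fun _ => 0) (hp.measurableSet.diff hD), lintegral_zero]
    filter_upwards [ae_deriv_coord_eq_zero hp (f t 0)] with s hs hs'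
    have h0 : f s 0 = f t 0 := not_not.1 hs'.2
    have : cross (deriv f s) (f s - f t) = 0 := by
      simp [cross, hs hs'.1 h0, h0]
    simp [paramKernel, this]
  rw [hzero, add_zero]
  refine setLIntegral_congr_fun hS fun s hs => ?_
  have h0 : (f s - f t) 0 ≠ 0 := by simpa using sub_ne_zero.2 hs.2
  simp only [Pi.mul_apply, Function.comp_apply]
  rw [det_fderiv_real, (hasDerivAt_chordSlope (hp.differentiableAt s hs.1) hs.2).deriv, ← mul_assoc,
    ← ENNReal.ofReal_mul (abs_nonneg _), mul_comm, paramKernel, ← lineDensity_mul_eq h0]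
  simp [chordSlope]

/-- The second moment of the number of crossings. -/
theorem lintegral_paramCrossings_sq (hp : IsParam f T) {ϑ : ℝ → ℝ≥0∞} (hϑ : Measurable ϑ) :
    ∫⁻ p : ℝ × ℝ, ENNReal.ofReal (lineDensity p.1) * paramCrossings f T ϑ p ^ 2 =
      ∫⁻ t in T, ϑ t * (2 * ‖deriv f t‖ₑ * ϑ t +
        ∫⁻ s in T, ϑ s * ENNReal.ofReal (paramKernel f t s)) := by
  obtain ⟨N', hN', hN⟩ := aemeasurable_paramCrossings hp hϑ
  have hG : Measurable fun p : ℝ × ℝ => ENNReal.ofReal (lineDensity p.1) * N' p :=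
    (measurable_lineDensity.comp measurable_fst).ennreal_ofReal.mul hN'
  -- One factor of the square is replaced by a measurable representative `N'`. Along lines through
  -- `f t` it may be wrong only where the Jacobian vanishes, up to null sets, and there the
  -- integrand is zero.
  have hae := ae_det_eq_zero_or_of_ae (volume : Measure (ℝ × ℝ))
    (measurable_lineThrough hp.measurable) (MeasurableSet.univ.prod hp.measurableSet)
    (fun p hp' => (hasFDerivAt_lineThrough (hp.differentiableAt _ hp'.2)).differentiableAt) hN
  rw [Measure.volume_eq_prod, ← Measure.prod_restrict, Measure.restrict_univ] at hae
  have hae2 := Measure.ae_ae_of_ae_prod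
    (Measure.measurePreserving_swap.quasiMeasurePreserving.ae hae)
  have h1 : ∫⁻ p : ℝ × ℝ, ENNReal.ofReal (lineDensity p.1) * paramCrossings f T ϑ p ^ 2 =
      ∫⁻ p : ℝ × ℝ, ENNReal.ofReal (lineDensity p.1) * N' p * paramCrossings f T ϑ p := by
    refine lintegral_congr_ae ?_
    filter_upwards [hN] with p hp'
    rw [sq, ← mul_assoc, ← hp']
  rw [h1, lintegral_mul_paramCrossings hp hϑ hG]
  refine lintegral_congr_ae ?_
  filter_upwards [hae2, ae_restrict_mem hp.measurableSet] with t ht htT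
  congr 1
  have hm : Measurable fun m => ENNReal.ofReal (lineDensity m * |lineForm m (deriv f t)|) := by
    have h4 : Measurable fun m => lineForm m (deriv f t) := by unfold lineForm; fun_prop
    exact (measurable_lineDensity.mul h4.abs).ennreal_ofReal
  calc ∫⁻ m, ENNReal.ofReal |lineForm m (deriv f t)| *
        (ENNReal.ofReal (lineDensity m) * N' (m, lineForm m (f t)))
      = ∫⁻ m, (ENNReal.ofReal (lineDensity m * |lineForm m (deriv f t)|) * ϑ t +
        ENNReal.ofReal (lineDensity m * |lineForm m (deriv f t)|) *
          fiberSum (chordSlope f t) (T ∩ {s | f s 0 ≠ f t 0}) ϑ m) := by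
        refine lintegral_congr_ae ?_
        filter_upwards [ht] with m hm
        rw [← mul_add, ← paramCrossings_lineThrough hp ϑ htT m,
          ENNReal.ofReal_mul (lineDensity_nonneg m)]
        simp only [Prod.swap_prod_mk] at hm
        rw [det_fderiv_lineThrough (p := (m, t)) (hp.differentiableAt t htT)] at hm
        rcases hm with h0 | h0
        · simp only at h0
          simp [h0]
        · rw [show N' (m, lineForm m (f t)) = paramCrossings f T ϑ (m, lineForm m (f t)) from
            h0.symm]
          ring
    _ = _ := by
        rw [lintegral_add_left (hm.mul_const _), lintegral_mul_const _ hm,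
          lintegral_lineDensity_mul_lineForm, lintegral_fiberSum_chordSlope hp hϑ]

end Crossings

/-! ### Crofton's formula and its quadratic version -/

lemma IsParam.measurableSet_image {f : ℝ → Plane} {T : Set ℝ} (hp : IsParam f T) :
    MeasurableSet (f '' T) := hp.measurableSet.image_of_measurable_injOn hp.measurable hp.injOn

/-- The length formula, applied to the times spent in each measurable set. -/
lemma IsParam.restrict_hausdorffMeasure {f : ℝ → Plane} {T : Set ℝ} (hp : IsParam f T) :
    (μH[1] : Measure Plane).restrict (f '' T) =
      ((volume.restrict T).withDensity fun t => ‖deriv f t‖ₑ).map f := by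
  ext E hE
  rw [Measure.map_apply hp.measurable hE, withDensity_apply _ (hp.measurable hE),
    Measure.restrict_apply hE, Measure.restrict_restrict (hp.measurable hE),
    ← hausdorffMeasure_image_eq_lintegral ((hp.measurable hE).inter hp.measurableSet)
      (fun t ht => hp.differentiableAt t ht.2) (hp.injOn.mono inter_subset_right),
    inter_comm (f ⁻¹' E), image_inter_preimage, inter_comm E]

lemma IsParam.setLIntegral_image {f : ℝ → Plane} {T : Set ℝ} (hp : IsParam f T)
    {h : Plane → ℝ≥0∞} (hh : Measurable h) :
    ∫⁻ x in f '' T, h x ∂μH[1] = ∫⁻ t in T, ‖deriv f t‖ₑ * h (f t) := by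
  rw [hp.restrict_hausdorffMeasure, lintegral_map hh hp.measurable]
  exact lintegral_withDensity_eq_lintegral_mul _ (measurable_deriv f).enorm
    (hh.comp hp.measurable)

lemma IsRectifiable.mono {A B : Set Plane} (hA : IsRectifiable A) (h : B ⊆ A) :
    IsRectifiable B := by
  obtain ⟨γ, hγ, h0⟩ := hA
  exact ⟨γ, hγ, measure_mono_null (sdiff_subset_sdiff_left h) h0⟩

/-- A rectifiable set with multiplicities in terms of a parametrization. -/
theorem exists_isParam_arclength {θ : Plane → ℕ} (hθ : AEMeasurable θ μH[1])
    (hr : IsRectifiable (Function.support θ)) :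
    ∃ (f : ℝ → Plane) (T : Set ℝ), IsParam f T ∧ μH[1] (Function.support θ \ f '' T) = 0 ∧
      f '' T ⊆ Function.support θ ∧
      (∃ ϑ : ℝ → ℕ, Measurable ϑ ∧ ∀ t ∈ T, ϑ t = θ (f t)) ∧
      ∀ G : Plane → ℝ≥0∞, ∫⁻ x, G x ∂arclength θ =
        ∫⁻ t in T, (θ (f t) : ℝ≥0∞) * ‖deriv f t‖ₑ * G (f t) := by
  obtain ⟨θ', hθ'm, hθ'⟩ := hθ
  set N := toMeasurable μH[1] {x | θ x ≠ θ' x} with hN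
  have hNm : MeasurableSet N := measurableSet_toMeasurable _ _
  have hN0 : μH[1] N = 0 := by rw [hN, measure_toMeasurable]; exact hθ'
  have hNe : ∀ x ∉ N, θ x = θ' x := fun x hx => by
    by_contra h
    exact hx (subset_toMeasurable _ _ h)
  -- Removing `N` makes `θ'` agree with `θ` everywhere on `B`, so the multiplicities agree at every
  -- time in `T`.
  set B := θ' ⁻¹' {0}ᶜ \ N with hB
  have hBm : MeasurableSet B := (hθ'm (measurableSet_singleton 0).compl).diff hNm
  have hBs : B ⊆ Function.support θ := fun x hx => by
    rw [Function.mem_support, hNe x hx.2]; exact hx.1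
  obtain ⟨f, T, hp, hfT, h0⟩ := exists_isParam hBm (hr.mono hBs)
  have hsupp : Function.support θ \ f '' T ⊆ N ∪ (B \ f '' T) := by
    rintro x ⟨hx, hx'⟩
    by_cases hxN : x ∈ N
    · exact Or.inl hxN
    · refine Or.inr ⟨⟨?_, hxN⟩, hx'⟩
      rw [Function.mem_support, hNe x hxN] at hx
      exact hx
  have h1 : μH[1] (Function.support θ \ f '' T) = 0 :=
    measure_mono_null hsupp (measure_union_null hN0 h0)
  have hϑ : ∀ t ∈ T, θ' (f t) = θ (f t) := fun t ht => (hNe _ (hfT ⟨t, ht, rfl⟩).2).symm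
  refine ⟨f, T, hp, h1, hfT.trans hBs, ⟨θ' ∘ f, hθ'm.comp hp.measurable, hϑ⟩, fun G => ?_⟩
  have hcast : Measurable fun x : Plane => (θ' x : ℝ≥0∞) :=
    (measurable_from_top (f := fun n : ℕ => (n : ℝ≥0∞))).comp hθ'm
  have hρ : Measurable fun t : ℝ => (θ' (f t) : ℝ≥0∞) * ‖deriv f t‖ₑ :=
    (hcast.comp hp.measurable).mul (measurable_deriv f).enorm
  -- A measurable embedding, with a finite density, transfers integrals of arbitrary `G`. This is
  -- needed because the inner integral of the energy is not known to be measurable.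
  have hemb : MeasurableEmbedding (T.domRestrict f) :=
    ContinuousOn.measurableEmbedding hp.measurableSet
      (fun t ht => (hp.differentiableAt t ht).continuousAt.continuousWithinAt) hp.injOn
  have harc : arclength θ = ((μH[1] : Measure Plane).restrict (f '' T)).withDensity
      fun x => (θ' x : ℝ≥0∞) := by
    rw [← withDensity_indicator hp.measurableSet_image]
    refine withDensity_congr_ae ?_
    filter_upwards [measure_eq_zero_iff_ae_notMem.1 h1, measure_eq_zero_iff_ae_notMem.1 hN0]
      with x hx hxN
    by_cases hxT : x ∈ f '' T
    · rw [indicator_of_mem hxT, hNe x hxN]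
    · rw [indicator_of_notMem hxT]
      have : θ x = 0 := by
        by_contra h
        exact hx ⟨h, hxT⟩
      simp [this]
  have hmap : arclength θ = ((Measure.comap ((↑) : T → ℝ) volume).withDensity
      fun t : T => (θ' (f t) : ℝ≥0∞) * ‖deriv f t‖ₑ).map (T.domRestrict f) := by
    ext E hE
    have hpre : MeasurableSet (T.domRestrict f ⁻¹' E) := hemb.measurable hE
    have hind : Measurable (E.indicator fun x => (θ' x : ℝ≥0∞)) := hcast.indicator hE
    rw [Measure.map_apply hemb.measurable hE, withDensity_apply _ hpre, harc,
      withDensity_apply _ hE, ← lintegral_indicator hE, hp.setLIntegral_image hind,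
      ← lintegral_indicator hpre, ← lintegral_subtype_comap hp.measurableSet]
    refine lintegral_congr fun t => ?_
    by_cases ht : f t ∈ E
    · rw [indicator_of_mem ht, indicator_of_mem (show t ∈ T.domRestrict f ⁻¹' E from ht), mul_comm]
    · rw [indicator_of_notMem ht, mul_zero,
        indicator_of_notMem (show t ∉ T.domRestrict f ⁻¹' E from ht)]
  rw [hmap, hemb.lintegral_map, ← lintegral_subtype_comap hp.measurableSet]
  refine (lintegral_withDensity_eq_lintegral_mul_non_measurable _
    (hρ.comp measurable_subtype_coe) (Filter.Eventually.of_forall fun t => ?_) _).trans ?_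
  · exact ENNReal.mul_lt_top (by simp) enorm_lt_top
  · refine lintegral_congr fun t => ?_
    simp [hϑ t t.2]

/-- The number of points, counted with multiplicity `θ`, on the line of slope `m` and
intercept `c`. -/
def crossings (θ : Plane → ℕ) (m c : ℝ) : ℝ≥0∞ :=
  fiberSum (lineForm m) univ (fun x => (θ x : ℝ≥0∞)) c

/-- Integration over the lines of the plane. -/
def lineIntegral (F : ℝ → ℝ → ℝ≥0∞) : ℝ≥0∞ :=
  ∫⁻ m, ENNReal.ofReal (lineDensity m) * ∫⁻ c, F m c

lemma volume_lineForm_image_eq_zero {Z : Set Plane} (hZ : μH[1] Z = 0) (m : ℝ) :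
    volume (lineForm m '' Z) = 0 := by
  rw [← hausdorffMeasure_real]
  refine le_antisymm (((lineFormL m).lipschitz.hausdorffMeasure_image_le zero_le_one Z).trans ?_)
    zero_le
  rw [hZ, mul_zero]

/-- The part of the support missed by `f` has length zero, so it projects along slope `m` to a null
set of intercepts. On the rest `f` is a bijection between crossing times and crossing points. -/
lemma ae_crossings_eq {θ : Plane → ℕ} {f : ℝ → Plane} {T : Set ℝ} (hp : IsParam f T)
    (h0 : μH[1] (Function.support θ \ f '' T) = 0) {ϑ : ℝ → ℕ} (hϑ : ∀ t ∈ T, ϑ t = θ (f t))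
    (m : ℝ) : ∀ᵐ c, crossings θ m c = paramCrossings f T (fun t => (ϑ t : ℝ≥0∞)) (m, c) := by
  filter_upwards [measure_eq_zero_iff_ae_notMem.1 (volume_lineForm_image_eq_zero h0 m)] with c hc
  have h1 : crossings θ m c = fiberSum (lineForm m) (f '' T) (fun x => (θ x : ℝ≥0∞)) c := by
    refine tsum_congr fun x => ?_
    by_cases hx : lineForm m x = c
    · by_cases hxT : x ∈ f '' T
      · rw [indicator_of_mem (show x ∈ univ ∩ lineForm m ⁻¹' {c} from ⟨mem_univ _, hx⟩),
          indicator_of_mem (show x ∈ f '' T ∩ lineForm m ⁻¹' {c} from ⟨hxT, hx⟩)]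
      · have : θ x = 0 := by
          by_contra h
          exact hc ⟨x, ⟨h, hxT⟩, hx⟩
        simp [indicator, this]
    · rw [indicator_of_notMem fun H => hx H.2, indicator_of_notMem fun H => hx H.2]
  rw [h1, paramCrossings, fiberSum, fiberSum, ← tsum_subtype, ← tsum_subtype]
  have hbij : BijOn f (T ∩ (fun t => lineForm m (f t)) ⁻¹' {c}) (f '' T ∩ lineForm m ⁻¹' {c}) := by
    refine ⟨fun t ht => ⟨⟨t, ht.1, rfl⟩, ht.2⟩, hp.injOn.mono inter_subset_left, ?_⟩
    rintro _ ⟨⟨t, ht, rfl⟩, hx⟩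
    exact ⟨t, ⟨ht, hx⟩, rfl⟩
  rw [← Equiv.tsum_eq hbij.equiv]
  refine tsum_congr fun t => ?_
  simp only [BijOn.equiv, Equiv.ofBijective_apply, MapsTo.val_restrict_apply]
  rw [hϑ t t.2.1]

lemma lineIntegral_eq_lintegral {F : ℝ → ℝ → ℝ≥0∞} {H : ℝ × ℝ → ℝ≥0∞} (hH : AEMeasurable H)
    (h : ∀ m, ∀ᵐ c, F m c = H (m, c)) :
    lineIntegral F = ∫⁻ p : ℝ × ℝ, ENNReal.ofReal (lineDensity p.1) * H p := by
  rw [Measure.volume_eq_prod, lintegral_prod]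
  · refine lintegral_congr fun m => ?_
    rw [lintegral_congr_ae (h m)]
    exact (lintegral_const_mul' _ _ ENNReal.ofReal_ne_top).symm
  · exact (measurable_lineDensity.comp measurable_fst).ennreal_ofReal.aemeasurable.mul hH

/-- In the plane, `u` orthogonal to `ν` is a multiple of the rotated `ν`; the scalar `l` below is
that multiple. -/
lemma abs_inner_mul_norm {ν u w : Plane} (hν : ‖ν‖ = 1) (hu : inner ℝ ν u = 0) :
    |inner ℝ ν w| * ‖u‖ = |cross u w| := by
  have h1 : ν 0 ^ 2 + ν 1 ^ 2 = 1 := by rw [← norm_sq_eq, hν, one_pow]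
  rw [inner_eq] at hu ⊢
  rw [← sq_eq_sq₀ (by positivity) (abs_nonneg _), mul_pow, sq_abs, sq_abs, norm_sq_eq, cross]
  have h2 : u 0 = -(ν 0 * u 1 - ν 1 * u 0) * ν 1 := by linear_combination (-u 0) * h1 + ν 0 * hu
  have h3 : u 1 = (ν 0 * u 1 - ν 1 * u 0) * ν 0 := by linear_combination (-u 1) * h1 + ν 1 * hu
  set l := ν 0 * u 1 - ν 1 * u 0
  rw [h2, h3]
  linear_combination (l ^ 2 * (ν 0 * w 0 + ν 1 * w 1) ^ 2) * h1

lemma energyKernel_mul_norm {ν : Plane → Plane} (hν : ∀ x, ‖ν x‖ = 1) {f : ℝ → Plane} {t s : ℝ}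
    (ht : inner ℝ (ν (f t)) (deriv f t) = 0) (hs : inner ℝ (ν (f s)) (deriv f s) = 0) :
    ‖deriv f t‖ * ‖deriv f s‖ * energyKernel ν (f t) (f s) = paramKernel f t s := by
  rw [energyKernel, paramKernel, ← abs_inner_mul_norm (hν _) ht, ← abs_inner_mul_norm (hν _) hs,
    abs_mul, norm_sub_rev, real_inner_comm (ν (f s))]
  ring

section Crofton

variable {θ : Plane → ℕ}

/-- Crofton's formula. -/
theorem lineIntegral_crossings (hθ : AEMeasurable θ μH[1])
    (hr : IsRectifiable (Function.support θ)) :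
    lineIntegral (crossings θ) = 2 * arclength θ univ := by
  obtain ⟨f, T, hp, h0, -, ⟨ϑ, hϑm, hϑ⟩, hintegral⟩ := exists_isParam_arclength hθ hr
  have hm : Measurable fun t => (ϑ t : ℝ≥0∞) :=
    (measurable_from_top (f := fun n : ℕ => (n : ℝ≥0∞))).comp hϑm
  rw [lineIntegral_eq_lintegral (aemeasurable_paramCrossings hp hm)
    (fun m => ae_crossings_eq hp h0 hϑ m), lintegral_paramCrossings hp hm, ← lintegral_one, hintegral,
    ← lintegral_const_mul' _ _ ENNReal.ofNat_ne_top]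
  refine setLIntegral_congr_fun hp.measurableSet fun t ht => ?_
  simp only [hϑ t ht]
  ring

/-- The quadratic Crofton formula: the second moment of the number of crossings. -/
theorem lineIntegral_crossings_sq (hθ : AEMeasurable θ μH[1])
    (hr : IsRectifiable (Function.support θ)) :
    lineIntegral (fun m c => crossings θ m c ^ 2) = multisetEnergy θ + 2 * arclength θ univ := by
  obtain ⟨f, T, hp, h0, hsub, ⟨ϑ, hϑm, hϑ⟩, hintegral⟩ := exists_isParam_arclength hθ hr
  have hm : Measurable fun t => (ϑ t : ℝ≥0∞) :=
    (measurable_from_top (f := fun n : ℕ => (n : ℝ≥0∞))).comp hϑm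
  have hm1 : Measurable fun t => ((ϑ t - 1 : ℕ) : ℝ≥0∞) :=
    (measurable_from_top (f := fun n : ℕ => ((n - 1 : ℕ) : ℝ≥0∞))).comp hϑm
  have hd : Measurable fun t => ‖deriv f t‖ₑ := (measurable_deriv f).enorm
  have hν := isUnitNormalField_unitNormal hp h0
  have hnormal := hp.normal _ _ hν
  set ν := unitNormal (Function.support θ)
  rw [lineIntegral_eq_lintegral ((aemeasurable_paramCrossings hp hm).pow_const 2)
    (fun m => (ae_crossings_eq hp h0 hϑ m).mono fun c hc => by rw [hc]),
    lintegral_paramCrossings_sq hp hm, multisetEnergy, ← lintegral_one]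
  simp only [hintegral, mul_add]
  rw [lintegral_add_left (by fun_prop), add_comm, add_assoc]
  congr 1
  · have hrestr := (ae_restrict_iff' hp.measurableSet).2 (hnormal.mono fun t h ht =>
      h ht (hsub ⟨t, ht, rfl⟩))
    refine lintegral_congr_ae ?_
    filter_upwards [hrestr, ae_restrict_mem hp.measurableSet] with t ht htT
    rw [hϑ t htT, mul_assoc, ← lintegral_const_mul' _ _ enorm_ne_top]
    congr 1
    refine lintegral_congr_ae ?_
    filter_upwards [hrestr, ae_restrict_mem hp.measurableSet] with s hs hsT
    rw [hϑ s hsT, ← energyKernel_mul_norm hν.1 ht hs, ENNReal.ofReal_mul (by positivity),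
      ENNReal.ofReal_mul (by positivity), ofReal_norm, ofReal_norm]
    ring
  -- Coincident pairs: `2 θ² = 2 θ (θ - 1) + 2 θ`. On the image of `f` the multiplicity is at least
  -- `1`, so the truncated subtraction is exact.
  · rw [← mul_add, ← lintegral_add_right' _ ?_, ← lintegral_const_mul' _ _ ENNReal.ofNat_ne_top]
    · refine setLIntegral_congr_fun hp.measurableSet fun t ht => ?_
      have h1 : θ (f t) ≠ 0 := hsub ⟨t, ht, rfl⟩
      obtain ⟨k, hk⟩ := Nat.exists_eq_succ_of_ne_zero h1
      simp only [hϑ t ht, hk, Nat.succ_sub_one, Nat.cast_succ]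
      ring
    · refine AEMeasurable.congr (f := fun t => (ϑ t : ℝ≥0∞) * ‖deriv f t‖ₑ * 1)
        (by fun_prop) ?_
      filter_upwards [ae_restrict_mem hp.measurableSet] with t ht
      rw [hϑ t ht]

end Crofton

/-! ### Crossings of sets with lines -/

lemma crossings_setMultiplicity (A : Set Plane) (m c : ℝ) :
    crossings (setMultiplicity A) m c = ((A ∩ lineForm m ⁻¹' {c}).encard : ℝ≥0∞) := by
  rw [← ENNReal.tsum_set_one, tsum_subtype (A ∩ lineForm m ⁻¹' {c}) (fun _ => (1 : ℝ≥0∞)),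
    crossings, fiberSum]
  refine tsum_congr fun x => ?_
  by_cases h1 : x ∈ A <;> by_cases h2 : lineForm m x = c <;>
    simp [setMultiplicity, indicator, h1, h2]

lemma crossings_add (θ₁ θ₂ : Plane → ℕ) (m c : ℝ) :
    crossings (θ₁ + θ₂) m c = crossings θ₁ m c + crossings θ₂ m c := by
  simp only [crossings, fiberSum]
  rw [← ENNReal.tsum_add]
  refine tsum_congr fun x => ?_
  by_cases h : lineForm m x = c <;> simp [indicator, h]

lemma crossings_nsmul (n : ℕ) (θ : Plane → ℕ) (m c : ℝ) :
    crossings (n • θ) m c = n * crossings θ m c := by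
  simp only [crossings, fiberSum]
  rw [← ENNReal.tsum_mul_left]
  refine tsum_congr fun x => ?_
  by_cases h : lineForm m x = c <;> simp [indicator, h]

lemma crossings_eq_zero {θ : Plane → ℕ} {m c : ℝ} (h : c ∉ lineForm m '' Function.support θ) :
    crossings θ m c = 0 := by
  refine ENNReal.tsum_eq_zero.2 fun x => ?_
  by_cases hx : x ∈ univ ∩ lineForm m ⁻¹' {c}
  · have : θ x = 0 := by
      by_contra h0
      exact h ⟨x, h0, hx.2⟩
    rw [indicator_of_mem hx, this, Nat.cast_zero]
  · rw [indicator_of_notMem hx]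

/-- A convergent sum of natural numbers has finitely many nonzero terms. This integrality is what
the energy bound exploits. -/
lemma crossings_eq_top_or_natCast (θ : Plane → ℕ) (m c : ℝ) :
    crossings θ m c = ∞ ∨ ∃ k : ℕ, crossings θ m c = k := by
  by_cases h : crossings θ m c = ∞
  · exact Or.inl h
  refine Or.inr ?_
  classical
  set a : Plane → ℕ := (univ ∩ lineForm m ⁻¹' {c}).indicator θ
  have ha : crossings θ m c = ∑' x, (a x : ℝ≥0∞) := by
    refine tsum_congr fun x => ?_
    by_cases hx : lineForm m x = c <;> simp [a, indicator, hx]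
  rw [ha] at h ⊢
  have hfin := ENNReal.finite_const_le_of_tsum_ne_top h one_ne_zero
  refine ⟨∑ x ∈ hfin.toFinset, a x, ?_⟩
  rw [Nat.cast_sum, tsum_eq_sum]
  intro x hx
  by_contra h0
  refine hx (hfin.mem_toFinset.2 ?_)
  have : a x ≠ 0 := fun h => h0 (by rw [h, Nat.cast_zero])
  exact_mod_cast Nat.one_le_iff_ne_zero.2 this

/-! ### Lines and convex sets -/

/-- An open bounded interval of the line. -/
lemma exists_eq_Ioo {I : Set ℝ} (ho : IsOpen I) (hc : Convex ℝ I) (hb : Bornology.IsBounded I)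
    (hne : I.Nonempty) : ∃ α β, α < β ∧ I = Ioo α β := by
  have hconn : IsConnected I := ⟨hne, hc.isPreconnected⟩
  have hsub : I ⊆ Ioo (sInf I) (sSup I) := by
    rw [← interior_Icc]
    exact interior_maximal (subset_Icc_csInf_csSup hb.bddBelow hb.bddAbove) ho
  obtain ⟨x, hx⟩ := hne
  exact ⟨sInf I, sSup I, (hsub hx).1.trans (hsub hx).2,
    hsub.antisymm (hconn.Ioo_csInf_csSup_subset hb.bddBelow hb.bddAbove)⟩

section ConvexDomain

variable {Ω : Set Plane}

lemma isOpen_lineForm_image (ho : IsOpen Ω) (m : ℝ) : IsOpen (lineForm m '' Ω) := by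
  refine ((lineFormL m).isOpenMap fun y => ⟨!₂[0, y], ?_⟩) Ω ho
  simp [coe_lineFormL, lineForm]

/-- Almost every line of given slope that meets the closure of a convex set meets the set. -/
lemma ae_mem_lineForm_image (ho : IsOpen Ω) (hc : Convex ℝ Ω) (m : ℝ) :
    ∀ᵐ c, c ∈ lineForm m '' closure Ω → c ∈ lineForm m '' Ω := by
  -- The exceptional intercepts are endpoints of an interval, the projection of `Ω`; they belong to
  -- supporting lines.
  have h1 : Convex ℝ (lineForm m '' Ω) := hc.linear_image (lineFormL m).toLinearMap
  filter_upwards [measure_eq_zero_iff_ae_notMem.1 (h1.addHaar_frontier volume)] with c hc hcl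
  by_contra h
  refine hc ?_
  rw [(isOpen_lineForm_image ho m).frontier_eq]
  refine ⟨image_closure_subset_closure_image (lineFormL m).continuous hcl, h⟩

/-- A line through a point of a bounded open convex set meets the boundary twice. -/
lemma encard_frontier_inter_line (ho : IsOpen Ω) (hc : Convex ℝ Ω) (hb : Bornology.IsBounded Ω)
    {p : Plane} (hp : p ∈ Ω) (m : ℝ) :
    (frontier Ω ∩ lineForm m ⁻¹' {lineForm m p}).encard = 2 := by
  let g : ℝ → Plane := fun s => p + s • (!₂[1, m] : Plane)
  have hg0 : ∀ s, g s 0 = p 0 + s := fun s => by simp [g]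
  have hg1 : ∀ s, g s 1 = p 1 + s * m := fun s => by simp [g]
  have hgc : Continuous g := by fun_prop
  have hgline : ∀ s, lineForm m (g s) = lineForm m p := fun s => by
    rw [lineForm, lineForm, hg0, hg1]; ring
  have hginj : Function.Injective g := fun s t h => by
    have := congrArg (fun x : Plane => x 0) h
    simp only [hg0] at this
    linarith
  have hgsurj : ∀ x, lineForm m x = lineForm m p → x = g (x 0 - p 0) := by
    intro x hx
    ext k
    fin_cases k
    · show x 0 = g (x 0 - p 0) 0
      rw [hg0]; ring
    · show x 1 = g (x 0 - p 0) 1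
      rw [hg1]
      simp only [lineForm] at hx
      linarith
  have hcombo : ∀ s t a b : ℝ, a + b = 1 → g (a * s + b * t) = a • g s + b • g t := by
    intro s t a b hab
    have : a • p + b • p = p := by rw [← add_smul, hab, one_smul]
    simp only [g, smul_add, add_smul, mul_smul]
    nth_rw 1 [← this]
    abel
  have hIconv : Convex ℝ (g ⁻¹' Ω) := by
    intro s hs t ht a b ha hb hab
    show g (a * s + b * t) ∈ Ω
    rw [hcombo s t a b hab]
    exact hc hs ht ha hb hab
  have hIbdd : Bornology.IsBounded (g ⁻¹' Ω) := by
    obtain ⟨R, hR⟩ := hb.exists_norm_le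
    refine isBounded_iff_forall_norm_le.2 ⟨R + |p 0|, fun s hs => ?_⟩
    have h1 := (PiLp.norm_apply_le (g s) 0).trans (hR _ hs)
    rw [hg0, Real.norm_eq_abs] at h1
    have h2 := abs_sub (p 0 + s) (p 0)
    rw [add_sub_cancel_left] at h2
    rw [Real.norm_eq_abs]
    linarith
  have h0 : g 0 = p := by simp [g]
  obtain ⟨α, β, hαβ, hI⟩ := exists_eq_Ioo (ho.preimage hgc) hIconv hIbdd ⟨0, by simpa [h0] using hp⟩
  have hcl : ∀ s, g s ∈ closure Ω ↔ s ∈ Icc α β := by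
    intro s
    rw [← closure_Ioo hαβ.ne, ← hI]
    refine ⟨fun hs => ?_, fun hs => hgc.closure_preimage_subset Ω hs⟩
    -- Since `p` is interior, a point of the line in the closure of `Ω` is approached from `p`
    -- through `Ω`.
    have hsub : openSegment ℝ 0 s ⊆ g ⁻¹' Ω := by
      rintro _ ⟨a, b, ha, hb, hab, rfl⟩
      have := hc.openSegment_interior_closure_subset_interior (ho.interior_eq.symm ▸ hp) hs
      have hmem : g (a * 0 + b * s) ∈ interior Ω := this ⟨a, b, ha, hb, hab, by
        rw [hcombo 0 s a b hab, h0]⟩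
      exact (interior_subset hmem : g (a * 0 + b * s) ∈ Ω)
    exact closure_mono hsub (segment_subset_closure_openSegment (right_mem_segment ℝ 0 s))
  have hset : frontier Ω ∩ lineForm m ⁻¹' {lineForm m p} = {g α, g β} := by
    ext x
    rw [ho.frontier_eq]
    constructor
    · rintro ⟨⟨hx, hx'⟩, hxl⟩
      rw [hgsurj x hxl] at hx hx' ⊢
      have h1 := (hcl _).1 hx
      have h2 : x 0 - p 0 ∉ Ioo α β := hI ▸ hx'
      rcases eq_endpoints_or_mem_Ioo_of_mem_Icc h1 with h | h | h
      · exact Or.inl (by rw [h])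
      · exact Or.inr (by rw [mem_singleton_iff, h])
      · exact absurd h h2
    · have hα : g α ∉ Ω := fun h => lt_irrefl α (hI ▸ h : α ∈ Ioo α β).1
      have hβ : g β ∉ Ω := fun h => lt_irrefl β (hI ▸ h : β ∈ Ioo α β).2
      rintro (rfl | rfl)
      · exact ⟨⟨(hcl α).2 (left_mem_Icc.2 hαβ.le), hα⟩, hgline α⟩
      · exact ⟨⟨(hcl β).2 (right_mem_Icc.2 hαβ.le), hβ⟩, hgline β⟩
  rw [hset, encard_pair (hginj.ne hαβ.ne)]

open Classical in
lemma ae_crossings_frontier (ho : IsOpen Ω) (hc : Convex ℝ Ω) (hb : Bornology.IsBounded Ω)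
    (m : ℝ) : ∀ᵐ c, crossings (setMultiplicity (frontier Ω)) m c =
      if c ∈ lineForm m '' Ω then 2 else 0 := by
  filter_upwards [ae_mem_lineForm_image ho hc m] with c h
  split_ifs with hcΩ
  · obtain ⟨p, hp, rfl⟩ := hcΩ
    rw [crossings_setMultiplicity, encard_frontier_inter_line ho hc hb hp]
    rfl
  · refine crossings_eq_zero fun H => hcΩ (h (image_mono ?_ H))
    intro x hx
    have : x ∈ frontier Ω := by
      by_contra h'
      exact hx (by simp [setMultiplicity, h'])
    exact frontier_subset_closure this

end ConvexDomain

/-- A line meets a segment at most once, except for one slope. -/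
lemma ae_crossings_segment (a b : Plane) : ∀ᵐ m : ℝ, ∀ c,
    crossings (setMultiplicity (segment ℝ a b)) m c ≤ 1 := by
  have h1 : ∀ᵐ m : ℝ, a = b ∨ lineForm m a ≠ lineForm m b := by
    by_cases hab : a = b
    · exact Filter.Eventually.of_forall fun _ => Or.inl hab
    have hsub : {m : ℝ | lineForm m a = lineForm m b}.Subsingleton := by
      intro m hm k hk
      by_contra hmk
      simp only [lineForm, mem_ofPred_eq] at hm hk
      have h0 : (m - k) * (a 0 - b 0) = 0 := by linarith
      rcases mul_eq_zero.1 h0 with h | h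
      · exact hmk (sub_eq_zero.1 h)
      · refine hab ?_
        have h2 : a 0 = b 0 := sub_eq_zero.1 h
        ext i
        fin_cases i
        · exact h2
        · rw [h2] at hm
          show a 1 = b 1
          linarith
    filter_upwards [measure_eq_zero_iff_ae_notMem.1 (hsub.measure_zero volume)] with m hm
    exact Or.inr hm
  filter_upwards [h1] with m hm c
  rw [crossings_setMultiplicity]
  have h2 : (segment ℝ a b ∩ lineForm m ⁻¹' {c}).encard ≤ 1 := by
    rw [encard_le_one_iff]
    rintro x y ⟨hx, hxc⟩ ⟨hy, hyc⟩
    rw [segment_eq_image_lineMap] at hx hy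
    obtain ⟨s, -, rfl⟩ := hx
    obtain ⟨t, -, rfl⟩ := hy
    rcases hm with rfl | hm
    · simp
    · have h3 : ∀ r, lineForm m (AffineMap.lineMap a b r) =
          lineForm m a + r * (lineForm m b - lineForm m a) := fun r => by
        rw [← coe_lineFormL, AffineMap.lineMap_apply]
        simp only [vsub_eq_sub, vadd_eq_add, map_add, map_smul, map_sub, smul_eq_mul]
        ring
      have h4 : lineForm m (AffineMap.lineMap a b s) = lineForm m (AffineMap.lineMap a b t) :=
        (show _ = c from hxc).trans (show _ = c from hyc).symm
      rw [h3, h3] at h4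
      have h5 : s = t := mul_right_cancel₀ (sub_ne_zero.2 hm.symm) (add_left_cancel h4)
      rw [h5]
  exact_mod_cast h2

/-! ### Rectifiability of boundaries of convex sets and of segments -/

lemma IsRectifiable.of_subset_range {A : Set Plane} {γ : ℝ → Plane} {C : ℝ≥0}
    (hγ : LipschitzWith C γ) (h : A ⊆ range γ) : IsRectifiable A := by
  refine ⟨fun _ => γ, fun _ => ⟨C, hγ⟩, ?_⟩
  rw [iUnion_const, sdiff_eq_empty.2 h, measure_empty]

lemma IsRectifiable.empty : IsRectifiable ∅ :=
  .of_subset_range (LipschitzWith.const (0 : Plane)) (empty_subset _)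

lemma IsRectifiable.iUnion {ι : Type*} [Countable ι] {A : ι → Set Plane}
    (hA : ∀ i, IsRectifiable (A i)) : IsRectifiable (⋃ i, A i) := by
  rcases isEmpty_or_nonempty ι with h | h
  · rw [iUnion_of_empty]
    exact .empty
  obtain ⟨e, he⟩ := exists_surjective_nat ι
  choose γ hγ h0 using hA
  refine ⟨fun k => γ (e k.unpair.1) k.unpair.2, fun k => hγ _ _, ?_⟩
  refine measure_mono_null ?_ (measure_iUnion_null h0)
  rintro x ⟨hx, hx'⟩
  obtain ⟨i, hi⟩ := mem_iUnion.1 hx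
  refine mem_iUnion.2 ⟨i, hi, fun H => hx' ?_⟩
  obtain ⟨j, hj⟩ := mem_iUnion.1 H
  obtain ⟨k, rfl⟩ := he i
  refine mem_iUnion.2 ⟨Nat.pair k j, ?_⟩
  simpa using hj

lemma IsRectifiable.union {A B : Set Plane} (hA : IsRectifiable A) (hB : IsRectifiable B) :
    IsRectifiable (A ∪ B) := by
  rw [union_eq_iUnion]
  exact .iUnion fun b => by cases b <;> assumption

lemma isRectifiable_segment (a b : Plane) : IsRectifiable (segment ℝ a b) := by
  have hl : LipschitzWith ‖b - a‖₊ fun t : ℝ => a + t • (b - a) := by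
    refine LipschitzWith.of_dist_le_mul fun s t => ?_
    rw [dist_add_left, dist_eq_norm, ← sub_smul, norm_smul, dist_eq_norm, coe_nnnorm, mul_comm]
  refine .of_subset_range hl ?_
  rw [segment_eq_image']
  rintro _ ⟨t, -, rfl⟩
  exact ⟨t, rfl⟩

/-- The nearest-point projection to a closed convex set. -/
lemma exists_convex_projection {K : Set Plane} (hne : K.Nonempty) (hcl : IsClosed K)
    (hc : Convex ℝ K) : ∃ π : Plane → Plane, LipschitzWith 1 π ∧
      ∀ z, ∀ p ∈ K, (∀ w ∈ K, inner ℝ (z - p) (w - p) ≤ 0) → π z = p := by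
  have hex : ∀ z, ∃ v ∈ K, ∀ w ∈ K, inner ℝ (z - v) (w - v) ≤ 0 := fun z => by
    obtain ⟨v, hv, h⟩ := exists_norm_eq_iInf_of_complete_convex hne hcl.isComplete hc z
    exact ⟨v, hv, (norm_eq_iInf_iff_real_inner_le_zero hc hv).1 h⟩
  choose π hπK hπ using hex
  refine ⟨π, LipschitzWith.of_dist_le_mul fun x y => ?_, fun z p hp h => ?_⟩
  · rw [NNReal.coe_one, one_mul, dist_eq_norm, dist_eq_norm]
    have h1 := hπ x (π y) (hπK y)
    have h2 := hπ y (π x) (hπK x)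
    have h3 : ‖π x - π y‖ * ‖π x - π y‖ ≤ inner ℝ (x - y) (π x - π y) := by
      rw [← real_inner_self_eq_norm_mul_norm]
      simp only [inner_eq, PiLp.sub_apply] at h1 h2 ⊢
      linarith
    rcases (norm_nonneg (π x - π y)).eq_or_lt with h0 | h0
    · rw [← h0]; exact norm_nonneg _
    · exact le_of_mul_le_mul_right (h3.trans (real_inner_le_norm _ _)) h0
  · have h1 := hπ z p hp
    have h2 := h (π z) (hπK z)
    have h3 : inner ℝ (π z - p) (π z - p) ≤ 0 := by
      simp only [inner_eq, PiLp.sub_apply] at h1 h2 ⊢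
      linarith
    rw [real_inner_self_eq_norm_sq] at h3
    exact sub_eq_zero.1 (norm_eq_zero.1 (pow_eq_zero_iff two_ne_zero |>.1
      (le_antisymm h3 (sq_nonneg _))))

lemma exists_angle {R : ℝ} {z : Plane} (hz : ‖z‖ = R) :
    ∃ t ∈ Icc (-Real.pi) Real.pi, z = R • (!₂[Real.cos t, Real.sin t] : Plane) := by
  set w : ℂ := ⟨z 0, z 1⟩ with hw
  have hn : ‖w‖ = R := by
    rw [← hz, ← sq_eq_sq₀ (norm_nonneg _) (norm_nonneg _), norm_sq_eq, ← Complex.normSq_eq_norm_sq,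
      Complex.normSq_apply]
    ring
  refine ⟨w.arg, ⟨(Complex.neg_pi_lt_arg w).le, Complex.arg_le_pi w⟩, ?_⟩
  have h0 := Complex.norm_mul_cos_arg w
  have h1 := Complex.norm_mul_sin_arg w
  rw [hn] at h0 h1
  ext k
  fin_cases k
  · simpa using h0.symm
  · simpa using h1.symm

/-- The boundary of a bounded open convex set is a Lipschitz curve of finite length. -/
lemma exists_lipschitz_frontier {Ω : Set Plane} (hne : Ω.Nonempty) (ho : IsOpen Ω)
    (hc : Convex ℝ Ω) (hb : Bornology.IsBounded Ω) :
    ∃ (γ : ℝ → Plane) (C : ℝ≥0), LipschitzWith C γ ∧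
      frontier Ω ⊆ γ '' Icc (-Real.pi) Real.pi := by
  obtain ⟨R₀, hR₀⟩ := hb.closure.exists_norm_le
  set R := max R₀ 1
  have hR : 0 < R := lt_max_of_lt_right one_pos
  obtain ⟨π, hπ, hπ'⟩ := exists_convex_projection hne.closure isClosed_closure hc.closure
  have hcirc : ∃ C, LipschitzWith C fun t : ℝ => R • (!₂[Real.cos t, Real.sin t] : Plane) := by
    refine ⟨(2 * R).toNNReal, LipschitzWith.of_dist_le_mul fun s t => ?_⟩
    rw [dist_eq_norm, ← smul_sub, norm_smul, Real.norm_of_nonneg hR.le,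
      Real.coe_toNNReal _ (by positivity), dist_eq_norm]
    have hcos : |Real.cos s - Real.cos t| ≤ |s - t| := by
      simpa [Real.dist_eq] using Real.lipschitzWith_cos.dist_le_mul s t
    have hsin : |Real.sin s - Real.sin t| ≤ |s - t| := by
      simpa [Real.dist_eq] using Real.lipschitzWith_sin.dist_le_mul s t
    have h1 : ‖(!₂[Real.cos s, Real.sin s] : Plane) - !₂[Real.cos t, Real.sin t]‖ ≤
        2 * ‖s - t‖ := by
      rw [← sq_le_sq₀ (norm_nonneg _) (by positivity), norm_sq_eq]
      have := sq_le_sq.2 (by rwa [abs_abs] : |Real.cos s - Real.cos t| ≤ |(|s - t|)|)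
      have := sq_le_sq.2 (by rwa [abs_abs] : |Real.sin s - Real.sin t| ≤ |(|s - t|)|)
      simp only [PiLp.sub_apply, Real.norm_eq_abs]
      simp
      nlinarith [sq_nonneg (|s - t|), sq_abs (s - t)]
    nlinarith
  obtain ⟨C, hC⟩ := hcirc
  refine ⟨_, _, hπ.comp hC, fun p hp => ?_⟩
  have hpK : p ∈ closure Ω := frontier_subset_closure hp
  have hpΩ : p ∉ Ω := by rw [ho.frontier_eq] at hp; exact hp.2
  obtain ⟨ℓ, hℓ⟩ := geometric_hahn_banach_open_point hc ho hpΩ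
  set u := (InnerProductSpace.toDual ℝ Plane).symm ℓ
  have hu : ∀ x, inner ℝ u x = ℓ x := fun x => InnerProductSpace.toDual_symm_apply
  have hu0 : u ≠ 0 := by
    obtain ⟨x, hx⟩ := hne
    intro h0
    have := hℓ x hx
    rw [← hu, ← hu, h0, inner_zero_left, inner_zero_left] at this
    exact lt_irrefl _ this
  have hle : ∀ w ∈ closure Ω, ℓ w ≤ ℓ p := fun w hw =>
    closure_minimal (fun x hx => (hℓ x hx).le) (isClosed_le ℓ.continuous continuous_const) hw
  -- The outer normal ray at `p` leaves the disc of radius `R`. Its point on the circle has nearest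
  -- point `p`, so the projection of the circle covers the boundary.
  obtain ⟨t, ht0, ht⟩ : ∃ t : ℝ, 0 ≤ t ∧ ‖p + t • u‖ = R := by
    have hcont : Continuous fun t : ℝ => ‖p + t • u‖ := by fun_prop
    set t₁ := (R + ‖p‖) / ‖u‖
    have ht₁ : 0 ≤ t₁ := by positivity
    have hun : 0 < ‖u‖ := norm_pos_iff.2 hu0
    have h1 : R ≤ ‖p + t₁ • u‖ := by
      have h2 := norm_sub_le (p + t₁ • u) p
      rw [add_sub_cancel_left, norm_smul, Real.norm_of_nonneg ht₁, div_mul_cancel₀ _ hun.ne'] at h2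
      linarith
    have h0 : ‖p + (0 : ℝ) • u‖ ≤ R := by
      rw [zero_smul, add_zero]
      exact (hR₀ p hpK).trans (le_max_left _ _)
    obtain ⟨t, ht, h⟩ := intermediate_value_Icc ht₁ hcont.continuousOn ⟨h0, h1⟩
    exact ⟨t, ht.1, h⟩
  obtain ⟨φ, hφ, hz⟩ := exists_angle ht
  refine ⟨φ, hφ, ?_⟩
  rw [Function.comp_apply, ← hz]
  refine hπ' _ p hpK fun w hw => ?_
  rw [add_sub_cancel_left, inner_smul_left, hu, map_sub]
  exact mul_nonpos_of_nonneg_of_nonpos ht0 (sub_nonpos.2 (hle w hw))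

lemma isRectifiable_frontier {Ω : Set Plane} (hne : Ω.Nonempty) (ho : IsOpen Ω)
    (hc : Convex ℝ Ω) (hb : Bornology.IsBounded Ω) : IsRectifiable (frontier Ω) := by
  obtain ⟨γ, C, hγ, h⟩ := exists_lipschitz_frontier hne ho hc hb
  exact .of_subset_range hγ (h.trans (image_subset_range _ _))

lemma hausdorffMeasure_frontier_ne_top {Ω : Set Plane} (hne : Ω.Nonempty) (ho : IsOpen Ω)
    (hc : Convex ℝ Ω) (hb : Bornology.IsBounded Ω) : μH[1] (frontier Ω) ≠ ∞ := by
  obtain ⟨γ, C, hγ, h⟩ := exists_lipschitz_frontier hne ho hc hb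
  refine ne_top_of_le_ne_top ?_ ((measure_mono h).trans
    (hγ.hausdorffMeasure_image_le zero_le_one _))
  rw [hausdorffMeasure_real, Real.volume_Icc]
  exact ENNReal.mul_ne_top (by simp) ENNReal.ofReal_ne_top

/-! ### The lower bound for the energy -/

lemma lineIntegral_mono {F G : ℝ → ℝ → ℝ≥0∞} (h : ∀ᵐ m, ∀ᵐ c, F m c ≤ G m c) :
    lineIntegral F ≤ lineIntegral G := by
  refine lintegral_mono_ae ?_
  filter_upwards [h] with m hm
  gcongr 1
  exact lintegral_mono_ae hm

lemma lineIntegral_congr {F G : ℝ → ℝ → ℝ≥0∞} (h : ∀ᵐ m, ∀ᵐ c, F m c = G m c) :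
    lineIntegral F = lineIntegral G :=
  le_antisymm (lineIntegral_mono (h.mono fun _ hm => hm.mono fun _ => le_of_eq))
    (lineIntegral_mono (h.mono fun _ hm => hm.mono fun _ => ge_of_eq))

lemma lineIntegral_const_mul {k : ℝ≥0∞} (hk : k ≠ ∞) (F : ℝ → ℝ → ℝ≥0∞) :
    lineIntegral (fun m c => k * F m c) = k * lineIntegral F := by
  simp only [lineIntegral]
  rw [← lintegral_const_mul' _ _ hk]
  refine lintegral_congr fun m => ?_
  rw [lintegral_const_mul' _ _ hk]
  ring

lemma exists_measurable_crossings {θ : Plane → ℕ} (hθ : AEMeasurable θ μH[1])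
    (hr : IsRectifiable (Function.support θ)) :
    ∃ H : ℝ × ℝ → ℝ≥0∞, Measurable H ∧ ∀ᵐ m, ∀ᵐ c, crossings θ m c = H (m, c) := by
  obtain ⟨f, T, hp, h0, -, ⟨ϑ, hϑm, hϑ⟩, -⟩ := exists_isParam_arclength hθ hr
  have hm : Measurable fun t => (ϑ t : ℝ≥0∞) :=
    (measurable_from_top (f := fun n : ℕ => (n : ℝ≥0∞))).comp hϑm
  obtain ⟨H, hH, hae⟩ := aemeasurable_paramCrossings hp hm
  refine ⟨H, hH, ?_⟩
  rw [Measure.volume_eq_prod] at hae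
  filter_upwards [Measure.ae_ae_of_ae_prod hae] with m hm
  filter_upwards [hm, ae_crossings_eq hp h0 hϑ m] with c h1 h2
  rw [h2, h1]

/-- Additivity needs only one measurable summand, and the crossings have a measurable version; `F`
is arbitrary. -/
lemma lineIntegral_add_mul_crossings {θ : Plane → ℕ} (hθ : AEMeasurable θ μH[1])
    (hr : IsRectifiable (Function.support θ)) {k : ℝ≥0∞} (hk : k ≠ ∞) (F : ℝ → ℝ → ℝ≥0∞) :
    lineIntegral (fun m c => F m c + k * crossings θ m c) =
      lineIntegral F + k * (2 * arclength θ univ) := by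
  obtain ⟨H, hH, hae⟩ := exists_measurable_crossings hθ hr
  rw [← lineIntegral_crossings hθ hr, lineIntegral_congr (G := fun m c => F m c + k * H (m, c)),
    lineIntegral_congr hae, ← lineIntegral_const_mul hk]
  · simp only [lineIntegral]
    rw [← lintegral_add_right]
    · refine lintegral_congr fun m => ?_
      rw [← mul_add]
      congr 1
      exact lintegral_add_right _ ((hH.comp measurable_prodMk_left).const_mul k)
    · exact measurable_lineDensity.ennreal_ofReal.mul (hH.const_mul k).lintegral_prod_right'
  · filter_upwards [hae] with m hm
    filter_upwards [hm] with c hc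
    rw [hc]

/-- This is `(N - 2n)(N - 2n - 1) ≥ 0`: no integer lies strictly between the two roots. -/
lemma mul_le_sq_add (n : ℕ) {N : ℝ≥0∞} (hN : N = ∞ ∨ ∃ k : ℕ, N = k) :
    (4 * n + 1) * N ≤ N ^ 2 + n * (2 * n + 1) * 2 := by
  rcases hN with rfl | ⟨k, rfl⟩
  · simp
  · norm_cast
    zify
    rcases le_or_gt (k : ℤ) (2 * n) with h | h
    · nlinarith
    · nlinarith [mul_nonneg (show (0 : ℤ) ≤ k - (2 * n + 1) by linarith)
        (show (0 : ℤ) ≤ k - 2 * n by linarith)]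

lemma measurable_setMultiplicity {A : Set Plane} (hA : MeasurableSet A) :
    Measurable (setMultiplicity A) := measurable_one.indicator hA

lemma support_setMultiplicity (A : Set Plane) : Function.support (setMultiplicity A) = A := by
  ext x; simp [setMultiplicity]

lemma arclength_setMultiplicity_univ {A : Set Plane} (hA : MeasurableSet A) :
    arclength (setMultiplicity A) univ = μH[1] A := by
  rw [arclength_setMultiplicity hA.nullMeasurableSet, Measure.restrict_apply_univ]

lemma isClosed_segment (a b : Plane) : IsClosed (segment ℝ a b) := by
  rw [segment_eq_image_lineMap]
  exact (isCompact_Icc.image AffineMap.lineMap_continuous).isClosed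

/-! ### The energy bound and its case of equality -/

section Minimizer

/-- A nonempty bounded open convex set. -/
structure IsConvexDomain (Ω : Set Plane) : Prop where
  nonempty : Ω.Nonempty
  isOpen : IsOpen Ω
  isBounded : Bornology.IsBounded Ω
  convex : Convex ℝ Ω

variable {Ω : Set Plane} {a b : Plane}

lemma IsConvexDomain.isRectifiable_frontier (hΩ : IsConvexDomain Ω) :
    IsRectifiable (frontier Ω) :=
  _root_.isRectifiable_frontier hΩ.nonempty hΩ.isOpen hΩ.convex hΩ.isBounded

lemma IsConvexDomain.hausdorffMeasure_frontier_ne_top (hΩ : IsConvexDomain Ω) :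
    μH[1] (frontier Ω) ≠ ∞ :=
  _root_.hausdorffMeasure_frontier_ne_top hΩ.nonempty hΩ.isOpen hΩ.convex hΩ.isBounded

/-- The lower bound for the second moment of the number of crossings. -/
lemma le_multisetEnergy_add (hΩ : IsConvexDomain Ω) (n : ℕ) {θ : Plane → ℕ} {L : ℝ}
    (hθ : IsRectifiableMultisetIn Ω L θ) :
    (4 * n + 1) * (2 * ENNReal.ofReal L) ≤ multisetEnergy θ + 2 * ENNReal.ofReal L +
      n * (2 * n + 1) * (2 * μH[1] (frontier Ω)) := by
  have hfr := hΩ.isRectifiable_frontier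
  have hk : (4 * n + 1 : ℝ≥0∞) ≠ ∞ := by finiteness
  have hk' : (n * (2 * n + 1) : ℝ≥0∞) ≠ ∞ := by finiteness
  rw [← hθ.length_eq, ← lineIntegral_crossings_sq hθ.measurable hθ.rectifiable,
    ← lineIntegral_crossings hθ.measurable hθ.rectifiable, ← lineIntegral_const_mul hk,
    ← arclength_setMultiplicity_univ isClosed_frontier.measurableSet,
    ← lineIntegral_add_mul_crossings (measurable_setMultiplicity
      isClosed_frontier.measurableSet).aemeasurable (by rwa [support_setMultiplicity]) hk']
  refine lineIntegral_mono (Filter.Eventually.of_forall fun m => ?_)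
  filter_upwards [ae_crossings_frontier hΩ.isOpen hΩ.convex hΩ.isBounded m,
    ae_mem_lineForm_image hΩ.isOpen hΩ.convex m] with c h1 h2
  rw [h1]
  split_ifs with h
  · exact mul_le_sq_add n (crossings_eq_top_or_natCast θ m c)
  -- Almost every line that misses `Ω` also misses its closure, hence the support of `θ`.
  · rw [crossings_eq_zero fun H => h (h2 (image_mono hθ.subset H))]
    simp

open Classical in
-- Almost every line meeting `Ω` thus has `2n` or `2n + 1` crossings, the roots of the quadratic
-- behind `mul_le_sq_add`.
lemma ae_crossings_minimizer (hΩ : IsConvexDomain Ω)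
    (hab : segment ℝ a b ⊆ closure Ω) (n : ℕ) : ∀ᵐ m, ∀ᵐ c,
    crossings (boundaryCopiesAndSegment Ω n a b) m c =
      n * crossings (setMultiplicity (frontier Ω)) m c +
        crossings (setMultiplicity (segment ℝ a b)) m c ∧
    crossings (setMultiplicity (frontier Ω)) m c = (if c ∈ lineForm m '' Ω then 2 else 0) ∧
    (crossings (setMultiplicity (segment ℝ a b)) m c = 0 ∨
      c ∈ lineForm m '' Ω ∧ crossings (setMultiplicity (segment ℝ a b)) m c = 1) := by
  filter_upwards [ae_crossings_segment a b] with m hm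
  filter_upwards [ae_crossings_frontier hΩ.isOpen hΩ.convex hΩ.isBounded m,
    ae_mem_lineForm_image hΩ.isOpen hΩ.convex m] with c h1 h2
  refine ⟨?_, h1, ?_⟩
  · rw [boundaryCopiesAndSegment, crossings_add, crossings_nsmul]
  by_cases h : c ∈ lineForm m '' Ω
  · have h3 := hm c
    rcases crossings_eq_top_or_natCast (setMultiplicity (segment ℝ a b)) m c with h4 | ⟨k, h4⟩
    · simp [h4] at h3
    · rw [h4] at h3 ⊢
      have h5 : k ≤ 1 := by exact_mod_cast h3
      interval_cases k
      · simp
      · simp [h]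
  · refine Or.inl (crossings_eq_zero fun H => h (h2 ?_))
    rw [support_setMultiplicity] at H
    exact image_mono hab H

lemma measurable_boundaryCopiesAndSegment (n : ℕ) :
    Measurable (boundaryCopiesAndSegment Ω n a b) := by
  have h1 := measurable_setMultiplicity (isClosed_frontier (s := Ω)).measurableSet
  have h2 := measurable_setMultiplicity (isClosed_segment a b).measurableSet
  exact (h1.const_smul n).add h2

lemma arclength_boundaryCopiesAndSegment (n : ℕ) :
    arclength (boundaryCopiesAndSegment Ω n a b) univ =
      n * μH[1] (frontier Ω) + edist a b := by
  have hf := (isClosed_frontier (s := Ω)).measurableSet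
  have hs := (isClosed_segment a b).measurableSet
  have h : ∀ x, (boundaryCopiesAndSegment Ω n a b x : ℝ≥0∞) =
      n * (frontier Ω).indicator 1 x + (segment ℝ a b).indicator 1 x := by
    intro x
    by_cases h1 : x ∈ frontier Ω <;> by_cases h2 : x ∈ segment ℝ a b <;>
      simp [boundaryCopiesAndSegment, setMultiplicity, h1, h2]
  rw [arclength, withDensity_apply _ MeasurableSet.univ, Measure.restrict_univ]
  simp_rw [h]
  rw [lintegral_add_right _ (measurable_one.indicator hs),
    lintegral_const_mul _ (measurable_one.indicator hf), lintegral_indicator_one hf,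
    lintegral_indicator_one hs, hausdorffMeasure_segment]

lemma isRectifiableMultisetIn_minimizer (hΩ : IsConvexDomain Ω)
    (hab : segment ℝ a b ⊆ closure Ω) (n : ℕ) {L : ℝ}
    (hL : dist a b = L - n * perimeter Ω) :
    IsRectifiableMultisetIn Ω L (boundaryCopiesAndSegment Ω n a b) := by
  have hsub : Function.support (boundaryCopiesAndSegment Ω n a b) ⊆
      frontier Ω ∪ segment ℝ a b := by
    intro x hx
    by_contra h
    rw [mem_union, not_or] at h
    exact hx (by simp [boundaryCopiesAndSegment, setMultiplicity, h.1, h.2])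
  refine ⟨hsub.trans (union_subset frontier_subset_closure hab),
    (measurable_boundaryCopiesAndSegment n).aemeasurable,
    (hΩ.isRectifiable_frontier.union (isRectifiable_segment a b)).mono hsub, ?_⟩
  have hP : 0 ≤ n * (μH[1] (frontier Ω)).toReal := by positivity
  rw [arclength_boundaryCopiesAndSegment, edist_dist, hL,
    ← ENNReal.ofReal_toReal hΩ.hausdorffMeasure_frontier_ne_top,
    ← ENNReal.ofReal_natCast, ← ENNReal.ofReal_mul (Nat.cast_nonneg n),
    ← ENNReal.ofReal_add hP (hL ▸ dist_nonneg)]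
  congr 1
  unfold perimeter
  ring

lemma multisetEnergy_minimizer_add (hΩ : IsConvexDomain Ω)
    (hab : segment ℝ a b ⊆ closure Ω) (n : ℕ) {L : ℝ} (hL : dist a b = L - n * perimeter Ω) :
    multisetEnergy (boundaryCopiesAndSegment Ω n a b) + 2 * ENNReal.ofReal L +
      n * (2 * n + 1) * (2 * μH[1] (frontier Ω)) = (4 * n + 1) * (2 * ENNReal.ofReal L) := by
  have hθ := isRectifiableMultisetIn_minimizer hΩ hab n hL
  have hfr := hΩ.isRectifiable_frontier
  have hk : (4 * n + 1 : ℝ≥0∞) ≠ ∞ := by finiteness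
  have hk' : (n * (2 * n + 1) : ℝ≥0∞) ≠ ∞ := by finiteness
  rw [← hθ.length_eq, ← lineIntegral_crossings_sq hθ.measurable hθ.rectifiable,
    ← lineIntegral_crossings hθ.measurable hθ.rectifiable, ← lineIntegral_const_mul hk,
    ← arclength_setMultiplicity_univ isClosed_frontier.measurableSet,
    ← lineIntegral_add_mul_crossings (measurable_setMultiplicity
      isClosed_frontier.measurableSet).aemeasurable (by rwa [support_setMultiplicity]) hk']
  refine lineIntegral_congr ?_
  filter_upwards [ae_crossings_minimizer hΩ hab n] with m hm
  filter_upwards [hm] with c h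
  obtain ⟨h1, h2, h3⟩ := h
  rw [h1, h2]
  rcases h3 with h3 | ⟨h3, h4⟩
  · rw [h3]
    split_ifs
    · ring
    · simp
  · rw [h4, if_pos h3]
    ring

theorem multisetEnergy_minimizer_le (hΩ : IsConvexDomain Ω)
    (hab : segment ℝ a b ⊆ closure Ω) (n : ℕ) {L : ℝ} (hL : dist a b = L - n * perimeter Ω)
    {θ : Plane → ℕ} (hθ : IsRectifiableMultisetIn Ω L θ) :
    multisetEnergy (boundaryCopiesAndSegment Ω n a b) ≤ multisetEnergy θ := by
  have h1 := multisetEnergy_minimizer_add hΩ hab n hL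
  have h2 := le_multisetEnergy_add hΩ n hθ
  rw [← h1] at h2
  have h3 := hΩ.hausdorffMeasure_frontier_ne_top
  rw [ENNReal.add_le_add_iff_right (by finiteness), ENNReal.add_le_add_iff_right (by finiteness)]
    at h2
  exact h2

end Minimizer

/-! ### Approximation by sets without multiplicity -/

/-- Among disjoint sets, infinitely many have null intersection with a set of finite length. -/
lemma infinite_null_inter {As : ℝ → Set Plane} {α β : ℝ} (hαβ : α < β)
    (hm : ∀ r ∈ Ioo α β, MeasurableSet (As r)) (hd : (Ioo α β).PairwiseDisjoint As)
    {B : Set Plane} (hB : μH[1] B ≠ ∞) :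
    {r ∈ Ioo α β | μH[1] (As r ∩ B) = 0}.Infinite := by
  have hfin : IsFiniteMeasure ((μH[1] : Measure Plane).restrict B) :=
    ⟨by rw [Measure.restrict_apply_univ]; exact hB.lt_top⟩
  have hcount := Measure.countable_meas_pos_of_disjoint_iUnion
    (μ := (μH[1] : Measure Plane).restrict B) (As := fun r : Ioo α β => As r)
    (fun r => hm r r.2) (fun r s hrs => hd r.2 s.2 fun h => hrs (Subtype.ext h))
  intro hfinite
  -- Disjoint sets of positive measure are countably many; were the others finite in number, the
  -- interval would be countable.
  have hcov : Ioo α β ⊆ {r ∈ Ioo α β | μH[1] (As r ∩ B) = 0} ∪ Subtype.val ''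
      {r : Ioo α β | 0 < (μH[1] : Measure Plane).restrict B (As r)} := by
    intro r hr
    by_cases h : μH[1] (As r ∩ B) = 0
    · exact Or.inl ⟨hr, h⟩
    · refine Or.inr ⟨⟨r, hr⟩, ?_, rfl⟩
      show 0 < (μH[1] : Measure Plane).restrict B (As r)
      rw [Measure.restrict_apply (hm r hr)]
      exact pos_iff_ne_zero.2 h
  have h0 := ((hfinite.countable.union (hcount.image _)).mono hcov).measure_zero volume
  rw [Real.volume_Ioo, ENNReal.ofReal_eq_zero] at h0
  linarith

/-! ### Homothetic copies of the boundary -/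

section Homothety

variable {Ω : Set Plane} {o : Plane} {r : ℝ}

lemma homothety_mem (hΩ : IsConvexDomain Ω) (ho : o ∈ Ω) (hr : r ∈ Ioo (0 : ℝ) 1) {p : Plane}
    (hp : p ∈ closure Ω) : AffineMap.homothety o r p ∈ Ω := by
  have h := hΩ.convex.openSegment_interior_closure_subset_interior
    (hΩ.isOpen.interior_eq.symm ▸ ho) hp
  refine interior_subset (h ⟨1 - r, r, by linarith [hr.2], hr.1, by ring, ?_⟩)
  rw [AffineMap.homothety_apply, vsub_eq_sub, vadd_eq_add]
  module

/-- A homothety as a homeomorphism. -/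
def homothetyHomeomorph (o : Plane) (hr : r ≠ 0) : Plane ≃ₜ Plane :=
  (Homeomorph.subRight o).trans ((Homeomorph.smulOfNeZero r hr).trans (Homeomorph.addRight o))

lemma coe_homothetyHomeomorph (hr : r ≠ 0) :
    ⇑(homothetyHomeomorph o hr) = AffineMap.homothety o r := by
  ext x
  simp [homothetyHomeomorph, AffineMap.homothety_apply]

lemma frontier_homothety_image (hr : r ≠ 0) :
    frontier (AffineMap.homothety o r '' Ω) = AffineMap.homothety o r '' frontier Ω := by
  rw [← coe_homothetyHomeomorph hr, (homothetyHomeomorph o hr).image_frontier]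

lemma isConvexDomain_homothety (hΩ : IsConvexDomain Ω) (ho : o ∈ Ω) (hr : r ∈ Ioo (0 : ℝ) 1) :
    IsConvexDomain (AffineMap.homothety o r '' Ω) := by
  refine ⟨hΩ.nonempty.image _, ?_, hΩ.isBounded.subset ?_, hΩ.convex.affine_image _⟩
  · rw [← coe_homothetyHomeomorph hr.1.ne']
    exact (homothetyHomeomorph o hr.1.ne').isOpenMap _ hΩ.isOpen
  · rintro _ ⟨p, hp, rfl⟩
    exact homothety_mem hΩ ho hr (subset_closure hp)

/-- A common point of the copies of ratios `r < s` would, after division by `s`, be a boundary point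
lying in the copy of ratio `r / s < 1`, which is inside `Ω`. -/
lemma pairwiseDisjoint_homothety_frontier (hΩ : IsConvexDomain Ω) (ho : o ∈ Ω) :
    (Ioo (0 : ℝ) 1).PairwiseDisjoint fun r => AffineMap.homothety o r '' frontier Ω := by
  have key : ∀ r s : ℝ, 0 < r → r < s → Disjoint (AffineMap.homothety o r '' frontier Ω)
      (AffineMap.homothety o s '' frontier Ω) := by
    intro r s hr hrs
    have hs := hr.trans hrs
    rw [Set.disjoint_left]
    rintro _ ⟨p, hp, rfl⟩ ⟨q, hq, hpq⟩
    have h1 : AffineMap.homothety o (r / s) p = q := by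
      simp only [AffineMap.homothety_apply, vsub_eq_sub, vadd_eq_add, add_left_inj] at hpq ⊢
      rw [div_eq_inv_mul, mul_smul, ← hpq, smul_smul, inv_mul_cancel₀ hs.ne', one_smul,
        sub_add_cancel]
    have h2 := homothety_mem hΩ ho ⟨div_pos hr hs, (div_lt_one hs).2 hrs⟩
      (frontier_subset_closure hp)
    rw [h1] at h2
    rw [hΩ.isOpen.frontier_eq] at hq
    exact hq.2 h2
  intro r hr s hs hrs
  rcases lt_or_gt_of_ne hrs with h | h
  · exact key r s hr.1 h
  · exact (key s r hs.1 h).symm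

open Classical in
lemma ae_crossings_homothety_frontier_le (hΩ : IsConvexDomain Ω) (ho : o ∈ Ω)
    (hr : r ∈ Ioo (0 : ℝ) 1) (m : ℝ) :
    ∀ᵐ c, crossings (setMultiplicity (AffineMap.homothety o r '' frontier Ω)) m c ≤
      if c ∈ lineForm m '' Ω then 2 else 0 := by
  have hΩ' := isConvexDomain_homothety hΩ ho hr
  have hsub : AffineMap.homothety o r '' Ω ⊆ Ω := by
    rintro _ ⟨p, hp, rfl⟩
    exact homothety_mem hΩ ho hr (subset_closure hp)
  rw [← frontier_homothety_image hr.1.ne']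
  filter_upwards [ae_crossings_frontier hΩ'.isOpen hΩ'.convex hΩ'.isBounded m] with c hc
  rw [hc]
  split_ifs with h1 h2 h2
  · exact le_rfl
  · exact absurd (image_mono hsub h1) h2
  · exact zero_le
  · exact le_rfl

end Homothety

lemma crossings_union_le (A B : Set Plane) (m c : ℝ) :
    crossings (setMultiplicity (A ∪ B)) m c ≤
      crossings (setMultiplicity A) m c + crossings (setMultiplicity B) m c := by
  simp only [crossings_setMultiplicity, union_inter_distrib_right]
  exact_mod_cast encard_union_le _ _

lemma crossings_biUnion_le (F : Finset ℝ) (A : ℝ → Set Plane) (m c : ℝ) :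
    crossings (setMultiplicity (⋃ r ∈ F, A r)) m c ≤
      ∑ r ∈ F, crossings (setMultiplicity (A r)) m c := by
  classical
  induction F using Finset.induction_on with
  | empty => simp [crossings_setMultiplicity]
  | insert r F hr ih =>
    rw [Finset.set_biUnion_insert, Finset.sum_insert hr]
    exact (crossings_union_le _ _ m c).trans (by gcongr)

/-- A horizontal segment of length `δ` starting above or below `o` at signed height `y`. -/
def horizontalSegment (o : Plane) (δ y : ℝ) : Set Plane :=
  segment ℝ (o + !₂[0, y]) (o + !₂[δ, y])

lemma horizontalSegment_subset_ball {o : Plane} {δ y ρ : ℝ} (hδ : 0 ≤ δ) (hδ' : δ < ρ / 2)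
    (hy : |y| < ρ / 2) : horizontalSegment o δ y ⊆ Metric.ball o ρ := by
  have hmem : ∀ x, |x| < ρ / 2 → o + !₂[x, y] ∈ Metric.ball o ρ := by
    intro x hx
    rw [Metric.mem_ball, dist_eq_norm, add_sub_cancel_left]
    have hρ : 0 < ρ := by linarith [abs_nonneg x]
    rw [← sq_lt_sq₀ (norm_nonneg _) hρ.le, norm_sq_eq]
    have h1 := sq_lt_sq₀ (abs_nonneg x) (by positivity) |>.2 hx
    have h2 := sq_lt_sq₀ (abs_nonneg y) (by positivity) |>.2 hy
    rw [sq_abs] at h1 h2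
    simp
    nlinarith
  exact (convex_ball o ρ).segment_subset (hmem 0 (by simpa using hδ.trans_lt hδ'))
    (hmem δ (by rwa [abs_of_nonneg hδ]))

lemma apply_one_of_mem_horizontalSegment {o x : Plane} {δ y : ℝ}
    (hx : x ∈ horizontalSegment o δ y) : x 1 = o 1 + y := by
  obtain ⟨s, t, -, -, hst, rfl⟩ := hx
  simp
  linear_combination (o 1 + y) * hst

lemma hausdorffMeasure_horizontalSegment {o : Plane} {δ y : ℝ} (hδ : 0 ≤ δ) :
    μH[1] (horizontalSegment o δ y) = ENNReal.ofReal δ := by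
  rw [horizontalSegment, hausdorffMeasure_segment, edist_dist, dist_add_left, dist_eq_norm]
  congr 1
  rw [← sq_eq_sq₀ (norm_nonneg _) hδ, norm_sq_eq]
  simp

lemma hausdorffMeasure_union_of_null_inter {A B : Set Plane} (hB : MeasurableSet B)
    (h : μH[1] (A ∩ B) = 0) : μH[1] (A ∪ B) = μH[1] A + μH[1] B := by
  rw [← measure_union_add_inter A hB, h, add_zero]

/-- Disjoint smaller copies of the boundary, together with the segment, have nearly the length
required. -/
lemma exists_copies {Ω : Set Plane} (hΩ : IsConvexDomain Ω) {o : Plane} (ho : o ∈ Ω) (n : ℕ)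
    (a b : Plane) {η : ℝ} (hη : 0 < η) :
    ∃ F : Finset ℝ, F.card = n ∧ (∀ r ∈ F, r ∈ Ioo (0 : ℝ) 1) ∧
      ∃ δ : ℝ, 0 ≤ δ ∧ δ ≤ η ∧ μH[1] ((⋃ r ∈ F, AffineMap.homothety o r '' frontier Ω) ∪
        segment ℝ a b) + ENNReal.ofReal δ =
        ENNReal.ofReal (n * perimeter Ω + dist a b) := by
  set P := perimeter Ω
  have hP : 0 ≤ P := ENNReal.toReal_nonneg
  have hPe : ENNReal.ofReal P = μH[1] (frontier Ω) :=
    ENNReal.ofReal_toReal hΩ.hausdorffMeasure_frontier_ne_top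
  -- Ratios above `1 - ε` lose at most `n ε P ≤ η` in total. The `1 / 2` keeps the ratios positive
  -- and the `+ 1` avoids division by zero.
  set ε := min (1 / 2) (η / (n * P + 1)) with hε
  have hnP : 0 ≤ n * P := by positivity
  have hε0 : 0 < ε := lt_min (by norm_num) (by positivity)
  have hε1 : ε < 1 := (min_le_left _ _).trans_lt (by norm_num)
  have hI : Ioo (1 - ε) 1 ⊆ Ioo (0 : ℝ) 1 := fun r hr => ⟨by linarith [hr.1], hr.2⟩
  have hcl : ∀ r ∈ Ioo (0 : ℝ) 1, MeasurableSet (AffineMap.homothety o r '' frontier Ω) := by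
    intro r hr
    rw [← frontier_homothety_image hr.1.ne']
    exact isClosed_frontier.measurableSet
  have hdisj := pairwiseDisjoint_homothety_frontier hΩ ho
  have hinf := infinite_null_inter (As := fun r => AffineMap.homothety o r '' frontier Ω)
    (B := segment ℝ a b) (show 1 - ε < 1 by linarith) (fun r hr => hcl r (hI hr))
    (hdisj.subset hI) (by rw [hausdorffMeasure_segment]; exact edist_ne_top a b)
  obtain ⟨F, hF, hFn⟩ := hinf.exists_subset_card_eq n
  have hF1 : ∀ r ∈ F, r ∈ Ioo (1 - ε) 1 := fun r hr => (hF hr).1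
  refine ⟨F, hFn, fun r hr => hI (hF1 r hr), ∑ r ∈ F, (1 - r) * P, ?_, ?_, ?_⟩
  · exact Finset.sum_nonneg fun r hr => mul_nonneg (by linarith [(hF1 r hr).2]) hP
  · calc ∑ r ∈ F, (1 - r) * P ≤ ∑ _r ∈ F, ε * P := Finset.sum_le_sum fun r hr =>
          mul_le_mul_of_nonneg_right (by linarith [(hF1 r hr).1]) hP
      _ = ε * (n * P) := by rw [Finset.sum_const, hFn, nsmul_eq_mul]; ring
      _ ≤ η / (n * P + 1) * (n * P) := by gcongr; exact min_le_right _ _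
      _ ≤ η := by
        rw [div_mul_eq_mul_div, div_le_iff₀ (by positivity)]
        nlinarith
  · have hmeas : ∀ r ∈ F, μH[1] (AffineMap.homothety o r '' frontier Ω) =
        ENNReal.ofReal (r * P) := by
      intro r hr
      have hr0 := (hI (hF1 r hr)).1
      rw [hausdorffMeasure_homothety_image zero_le_one o hr0.ne', NNReal.rpow_one,
        ENNReal.ofReal_mul hr0.le, hPe, ENNReal.smul_def, smul_eq_mul, Real.nnnorm_of_nonneg hr0.le,
        ENNReal.ofReal_eq_coe_nnreal]
    have hnull : μH[1] ((⋃ r ∈ F, AffineMap.homothety o r '' frontier Ω) ∩ segment ℝ a b) = 0 := by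
      rw [iUnion₂_inter]
      exact (measure_biUnion_null_iff F.countable_toSet).2 fun r hr => (hF hr).2
    rw [hausdorffMeasure_union_of_null_inter (isClosed_segment a b).measurableSet hnull,
      measure_biUnion_finset (hdisj.subset fun r hr => hI (hF1 r hr))
        (fun r hr => hcl r (hI (hF1 r hr))), Finset.sum_congr rfl hmeas, hausdorffMeasure_segment,
      edist_dist, ← ENNReal.ofReal_sum_of_nonneg fun r hr => mul_nonneg (hI (hF1 r hr)).1.le hP]
    have h1 : 0 ≤ ∑ r ∈ F, r * P :=
      Finset.sum_nonneg fun r hr => mul_nonneg (hI (hF1 r hr)).1.le hP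
    have h2 : 0 ≤ ∑ r ∈ F, (1 - r) * P :=
      Finset.sum_nonneg fun r hr => mul_nonneg (by linarith [(hF1 r hr).2]) hP
    rw [← ENNReal.ofReal_add h1 dist_nonneg, ← ENNReal.ofReal_add (by positivity) h2]
    congr 1
    have h3 : ∑ r ∈ F, r * P + ∑ r ∈ F, (1 - r) * P = n * P := by
      rw [← Finset.sum_add_distrib, Finset.sum_congr rfl fun r _ => show r * P + (1 - r) * P = P by
        ring, Finset.sum_const, hFn, nsmul_eq_mul]
    linarith

/-- Here `x` is the count for the minimizer, at most `2n + 1`, and `s` that for the short segment,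
so `2 x s + s² ≤ (4n + 3) s`. -/
lemma sq_le_sq_add_mul (n : ℕ) {x y s : ℝ≥0∞} (hs : s ≤ 1) (hx : x ≤ 2 * n + 1)
    (hy : y ≤ x + s) : y ^ 2 ≤ x ^ 2 + (4 * n + 3) * s := by
  calc y ^ 2 ≤ (x + s) ^ 2 := by gcongr
    _ = x ^ 2 + 2 * x * s + s * s := by ring
    _ ≤ x ^ 2 + 2 * (2 * n + 1) * s + 1 * s := by gcongr
    _ = _ := by ring

/-- The energy of the minimizer is approximated by sets without multiplicity. -/
theorem exists_isRectifiableSetIn_energy_le {Ω : Set Plane} (hΩ : IsConvexDomain Ω) {a b : Plane}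
    (hab : segment ℝ a b ⊆ closure Ω) (n : ℕ) {L : ℝ} (hL : dist a b = L - n * perimeter Ω)
    {η : ℝ} (hη : 0 < η) :
    ∃ A, IsRectifiableSetIn Ω L A ∧ energy A ≤
      multisetEnergy (boundaryCopiesAndSegment Ω n a b) +
        (4 * n + 3) * (2 * ENNReal.ofReal η) := by
  obtain ⟨o, ho⟩ := hΩ.nonempty
  obtain ⟨ρ, hρ, hball⟩ := Metric.isOpen_iff.1 hΩ.isOpen o ho
  -- The bound `ρ / 4` on the missing length lets a segment of that length fit in the ball around
  -- `o`.
  obtain ⟨F, hFn, hF, δ, hδ, hδη, hlen⟩ := exists_copies hΩ ho n a b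
    (η := min η (ρ / 4)) (lt_min hη (by positivity))
  set U := ⋃ r ∈ F, AffineMap.homothety o r '' frontier Ω with hU
  set K := segment ℝ a b with hK
  have hLe : n * perimeter Ω + dist a b = L := by linarith
  rw [hLe] at hlen
  have hδρ : δ < ρ / 2 := (hδη.trans (min_le_right _ _)).trans_lt (by linarith)
  have hcopy : ∀ r ∈ F, IsClosed (AffineMap.homothety o r '' frontier Ω) := fun r hr => by
    rw [← frontier_homothety_image (hF r hr).1.ne']
    exact isClosed_frontier
  have hUm : MeasurableSet U := F.measurableSet_biUnion fun r hr => (hcopy r hr).measurableSet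
  have hKm : MeasurableSet K := (isClosed_segment a b).measurableSet
  have hSm : ∀ y, MeasurableSet (horizontalSegment o δ y) := fun y =>
    (isClosed_segment _ _).measurableSet
  have hfin : μH[1] (U ∪ K) ≠ ∞ :=
    ne_top_of_le_ne_top ENNReal.ofReal_ne_top (le_self_add.trans hlen.le)
  -- Among the parallel positions, some height makes the overlap with the other pieces null, so the
  -- lengths add up to `L`.
  obtain ⟨y, hy, hy0⟩ := (infinite_null_inter (As := horizontalSegment o δ) (α := -(ρ / 2))
    (β := ρ / 2) (by linarith) (fun y _ => hSm y) (fun y _ z _ hyz => by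
      refine Set.disjoint_left.2 fun x hx hx' => hyz ?_
      have h1 := apply_one_of_mem_horizontalSegment hx
      have h2 := apply_one_of_mem_horizontalSegment hx'
      linarith) hfin).nonempty
  set S := horizontalSegment o δ y
  have hS : μH[1] S = ENNReal.ofReal δ := hausdorffMeasure_horizontalSegment hδ
  have hUr : IsRectifiable U := by
    have hU' : U = ⋃ r : F, AffineMap.homothety o (r : ℝ) '' frontier Ω := by
      rw [hU, iUnion_subtype]
    rw [hU']
    refine .iUnion fun r => ?_
    rw [← frontier_homothety_image (hF r r.2).1.ne']
    exact (isConvexDomain_homothety hΩ ho (hF r r.2)).isRectifiable_frontier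
  have hSr : IsRectifiable S := isRectifiable_segment _ _
  have hA : IsRectifiableSetIn Ω L (U ∪ K ∪ S) := by
    refine ⟨union_subset (union_subset (iUnion₂_subset fun r hr => ?_) hab) ?_,
      ((hUm.union hKm).union (hSm y)).nullMeasurableSet,
      (hUr.union (isRectifiable_segment a b)).union hSr, ?_⟩
    · rintro _ ⟨p, hp, rfl⟩
      exact subset_closure (homothety_mem hΩ ho (hF r hr) (frontier_subset_closure hp))
    · exact ((horizontalSegment_subset_ball hδ hδρ (abs_lt.2 hy)).trans hball).trans subset_closure
    · rw [hausdorffMeasure_union_of_null_inter (hSm y) (by rwa [inter_comm]), hS, hlen]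
  refine ⟨U ∪ K ∪ S, hA, ?_⟩
  have hθ := isRectifiableMultisetIn_minimizer hΩ hab n hL
  have hAm := ((hUm.union hKm).union (hSm y))
  have h1 := lineIntegral_crossings_sq (measurable_setMultiplicity hAm).aemeasurable
    (by rw [support_setMultiplicity]; exact hA.rectifiable)
  have h2 := lineIntegral_crossings_sq hθ.measurable hθ.rectifiable
  have h3 := lineIntegral_add_mul_crossings (measurable_setMultiplicity (hSm y)).aemeasurable
    (by rwa [support_setMultiplicity]) (k := 4 * n + 3) (by finiteness)
    (fun m c => crossings (boundaryCopiesAndSegment Ω n a b) m c ^ 2)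
  rw [arclength_setMultiplicity_univ hAm, hA.length_eq,
    multisetEnergy_setMultiplicity hAm.nullMeasurableSet] at h1
  rw [h2, hθ.length_eq, arclength_setMultiplicity_univ (hSm y), hS] at h3
  have h4 : lineIntegral (fun m c => crossings (setMultiplicity (U ∪ K ∪ S)) m c ^ 2) ≤
      lineIntegral (fun m c => crossings (boundaryCopiesAndSegment Ω n a b) m c ^ 2 +
        (4 * n + 3) * crossings (setMultiplicity S) m c) := by
    refine lineIntegral_mono ?_
    filter_upwards [ae_crossings_minimizer hΩ hab n, ae_crossings_segment (o + !₂[0, y])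
      (o + !₂[δ, y])] with m hm hmS
    filter_upwards [hm, (Filter.eventually_all_finset F).2 fun r hr =>
      ae_crossings_homothety_frontier_le hΩ ho (hF r hr) m] with c ⟨hc1, hc2, hc3⟩ hcF
    have hUc : crossings (setMultiplicity U) m c ≤
        n * crossings (setMultiplicity (frontier Ω)) m c := by
      rw [hc2]
      refine (crossings_biUnion_le F _ m c).trans ((Finset.sum_le_sum hcF).trans ?_)
      rw [Finset.sum_const, hFn, nsmul_eq_mul]
    refine sq_le_sq_add_mul n (hmS c) ?_ ?_
    · rw [hc1, hc2]
      have h5 : crossings (setMultiplicity K) m c ≤ 1 := by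
        rcases hc3 with h | h
        · rw [h]; exact zero_le
        · exact h.2.le
      calc _ ≤ (n : ℝ≥0∞) * 2 + 1 := by
            gcongr
            split_ifs
            · exact le_rfl
            · exact zero_le
        _ = _ := by ring
    · rw [hc1]
      exact (crossings_union_le _ _ m c).trans (add_le_add ((crossings_union_le _ _ m c).trans
        (add_le_add hUc le_rfl)) le_rfl)
  rw [h1, h3, add_right_comm] at h4
  refine (ENNReal.add_le_add_iff_right (by finiteness)).1 (h4.trans ?_)
  gcongr
  exact hδη.trans (min_le_left _ _)

/-- The maximal distance is attained in the compact closure. A segment realizing it is shortened by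
the intermediate value theorem and stays inside by convexity. -/
lemma exists_segment_of_dist_le_diam {Ω : Set Plane} (hΩ : IsConvexDomain Ω) {d : ℝ} (hd : 0 ≤ d)
    (hd' : d ≤ Metric.diam Ω) :
    ∃ a b : Plane, segment ℝ a b ⊆ closure Ω ∧ dist a b = d := by
  have hK : IsCompact (closure Ω) := Metric.isCompact_of_isClosed_isBounded isClosed_closure
    hΩ.isBounded.closure
  obtain ⟨⟨p, q⟩, ⟨hp, hq⟩, hmax⟩ := (hK.prod hK).exists_isMaxOn
    (hΩ.nonempty.closure.prod hΩ.nonempty.closure)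
    (f := fun x : Plane × Plane => dist x.1 x.2) continuous_dist.continuousOn
  have hdiam : d ≤ dist p q := by
    refine hd'.trans (Metric.diam_le_of_forall_dist_le dist_nonneg fun x hx y hy => ?_)
    exact isMaxOn_iff.1 hmax (x, y) ⟨subset_closure hx, subset_closure hy⟩
  have hcont : Continuous fun t : ℝ => dist p (AffineMap.lineMap p q t) := by
    have := AffineMap.lineMap_continuous (R := ℝ) (p := p) (q := q)
    fun_prop
  obtain ⟨t, ht, htd⟩ := intermediate_value_Icc zero_le_one hcont.continuousOn
    (show d ∈ Icc _ _ by simpa using ⟨hd, hdiam⟩)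
  refine ⟨p, _, hΩ.convex.closure.segment_subset hp ?_, htd⟩
  exact hΩ.convex.closure.segment_subset hp hq (by
    rw [segment_eq_image_lineMap]; exact ⟨t, ht, rfl⟩)

lemma IsRectifiableSetIn.isRectifiableMultisetIn {Ω A : Set Plane} {L : ℝ}
    (hA : IsRectifiableSetIn Ω L A) : IsRectifiableMultisetIn Ω L (setMultiplicity A) := by
  have hs := support_setMultiplicity A
  refine ⟨by rw [hs]; exact hA.subset, ?_, by rw [hs]; exact hA.rectifiable, ?_⟩
  · obtain ⟨B, -, hB, hBA⟩ := hA.measurable.exists_measurable_superset_ae_eq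
    refine ⟨setMultiplicity B, measurable_setMultiplicity hB, ?_⟩
    filter_upwards [hBA] with x hx
    have hx' : x ∈ B ↔ x ∈ A := iff_of_eq hx
    by_cases h : x ∈ A <;> simp [setMultiplicity, hx', h]
  · rw [arclength_setMultiplicity hA.measurable, Measure.restrict_apply_univ, hA.length_eq]

end

theorem theorem1 (Ω : Set Plane) (hne : Ω.Nonempty) (hopen : IsOpen Ω)
    (hbdd : Bornology.IsBounded Ω) (hconv : Convex ℝ Ω) (hC1 : HasC1Boundary Ω)
    (n : ℕ) (L : ℝ) (hL₀ : 0 ≤ L - n * perimeter Ω)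
    (hL₁ : L - n * perimeter Ω ≤ Metric.diam Ω) :
    (∃ a b : Plane, segment ℝ a b ⊆ closure Ω ∧ dist a b = L - n * perimeter Ω) ∧
    ∀ a b : Plane, segment ℝ a b ⊆ closure Ω → dist a b = L - n * perimeter Ω →
      IsRectifiableMultisetIn Ω L (boundaryCopiesAndSegment Ω n a b) ∧
      (∀ θ : Plane → ℕ, IsRectifiableMultisetIn Ω L θ →
        multisetEnergy (boundaryCopiesAndSegment Ω n a b) ≤ multisetEnergy θ) ∧
      IsGLB {e : ℝ≥0∞ | ∃ A : Set Plane, IsRectifiableSetIn Ω L A ∧ e = energy A}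
        (multisetEnergy (boundaryCopiesAndSegment Ω n a b)) := by
  have hΩ : IsConvexDomain Ω := ⟨hne, hopen, hbdd, hconv⟩
  refine ⟨exists_segment_of_dist_le_diam hΩ hL₀ hL₁, fun a b hab hL =>
    ⟨isRectifiableMultisetIn_minimizer hΩ hab n hL,
      fun θ hθ => multisetEnergy_minimizer_le hΩ hab n hL hθ, ?_, ?_⟩⟩
  · rintro _ ⟨A, hA, rfl⟩
    rw [← multisetEnergy_setMultiplicity hA.measurable]
    exact multisetEnergy_minimizer_le hΩ hab n hL hA.isRectifiableMultisetIn
  · intro e he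
    refine ENNReal.le_of_forall_pos_le_add fun ε hε _ => ?_
    -- This `η` makes the error `(4n + 3) · 2η` equal to `ε`.
    obtain ⟨A, hA, hle⟩ := exists_isRectifiableSetIn_energy_le hΩ hab n hL
      (η := ε / ((4 * n + 3) * 2)) (by positivity)
    refine (he ⟨A, hA, rfl⟩).trans (hle.trans_eq ?_)
    congr 1
    rw [show (4 * n + 3 : ℝ≥0∞) = ENNReal.ofReal (4 * n + 3) by
        rw [ENNReal.ofReal_add (by positivity) (by norm_num), ENNReal.ofReal_mul (by norm_num)]
        simp, show (2 : ℝ≥0∞) = ENNReal.ofReal 2 by simp, ← ENNReal.ofReal_mul (by norm_num),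
      ← ENNReal.ofReal_mul (by positivity), ← ENNReal.ofReal_coe_nnreal]
    congr 1
    field_simp
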